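/- Let $G=(V,E)$ be a finite simple undirected (unweighted) graph. A vertex order is a bijection $\pi:V\to\{1,\dots,|V|\}$; smaller values mean higher rank. The following three algorithms compute, for a given $\pi$, labels $L(v)$, i.e. sets of hubs $h$ stored with distances $d(h,v)$; minima over the empty set are $\infty$. PLL: for each $u\in V$ in the order $\pi$, run a BFS from $u$ with a queue initially containing $(u,0)$. When $(v,d)$ is popped and $d<\min_{h\in L(u)\cap L(v)}d(u,h)+d(h,v)$, add $(u,d)$ to $L(v)$ and enqueue $(v',d+1)$ for all neighbours $v'$ of $v$ that are unvisited by $u$ and satisfy $\pi(u)<\pi(v')$. VC-PLL: initially $L(v)=\delta L(v)=\{(v,0)\}$ for all $v$ and all vertices are active. While there are active vertices: (scatter) each active $a$ sends, for each neighbour $v$ and each $(u,d)\in\delta L(a)$ with $\pi(u)<\pi(v)$ and $u\notin L(v)$, the message $(u,d+1)$ to $v$; (gather) then the active set is emptied, and every $v$ with messages sets $\delta L(v)$ to the set of those distinct messages $(u,d)$ with $d<\min_{h\in L(u)\cap L(v)}d(u,h)+d(h,v)$, and, if $\delta L(v)\neq\emptyset$, adds $\delta L(v)$ to $L(v)$ and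 becomes active. BVC-PLL with batch size $b\ge 1$: initially all $L(v)$ are empty; $V$ is split by rank into consecutive batches of size $b$ (the last one may be smaller). For each batch $B$ in turn, set $\delta L(u)=\{(u,0)\}$ and add $(u,0)$ to $L(u)$ for $u\in B$, let $B$ be the active set, and run the scatter-gather loop of VC-PLL, with the test $u\notin L(v)$ replaced by $u\notin C(v)$, where $C(v)$ is the set of all $u\in B$ already sent to $v$, and with the label of each $u\in B$ kept in a table $H(u)$ so that a distance check only traverses $L(v)$. Running time is the total (sequential) number of elementary steps, with unit-cost array and table look-ups. The input consists of the adjacency lists of $G$ and the order $\pi$. Theorem. There is an absolute constant $C>0$ such that, for every $G$ and every tree decomposition of $G$ (over a finite tree) of width $w\ge 1$, there is a vertex order $\pi$ for which VC-PLL terminates within $$C\left(w\,|E|\log|V|+w^2\,|V|\,(\log|V|)^2\right)$$ steps. For the same order $\pi$, PLL and, for every batch size $b\ge1$, BVC-PLL also terminate within this number of steps. -/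

import Mathlib

universe u v

noncomputable section

/-! ### Imperative programs and their running time -/

/-- Imperative programs over a memory of type `σ`. The atomic instructions `op`, `read` and the tests
of `ite` and `loop` are used below only for operations that inspect or change a bounded number of
memory words: reading or writing an entry of an array (all arrays are indexed by vertices or by
pairs of vertices), a comparison or an addition, pushing onto a list, popping from a list,
appending to a queue, emptying a list variable, fetching a pointer to a list. -/
inductive Cmd (σ : Type u) : Type (u + 1)
  /-- do nothing -/
  | skip : Cmd σ
  /-- an elementary change of the memory -/
  | op (f : σ → σ) : Cmd σ
  /-- sequential composition -/
  | seq (c d : Cmd σ) : Cmd σ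
  /-- fetch a value from the memory, and continue with it -/
  | read {α : Type u} (f : σ → α) (k : α → Cmd σ) : Cmd σ
  /-- conditional -/
  | ite (b : σ → Bool) (c d : Cmd σ) : Cmd σ
  /-- while loop -/
  | loop (b : σ → Bool) (c : Cmd σ) : Cmd σ
  /-- traversal of a list -/
  | forList {α : Type u} (l : List α) (body : α → Cmd σ) : Cmd σ

infixr:55 " ;; " => Cmd.seq

/-- Conditional without an alternative. -/
def Cmd.when {σ : Type u} (b : σ → Bool) (c : Cmd σ) : Cmd σ := Cmd.ite b c Cmd.skip

/-- Traversal of a list that is stored in the memory (as it is when the traversal starts). -/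
def Cmd.forEach {σ α : Type u} (l : σ → List α) (body : α → Cmd σ) : Cmd σ :=
  Cmd.read l (fun xs => Cmd.forList xs body)

/-- `Exec c s s' t`: started in the memory `s`, the program `c` terminates in the memory `s'` after
exactly `t` elementary steps. Every elementary instruction, every evaluation of a test and every
round of a list traversal counts as one step. -/
inductive Exec {σ : Type u} : Cmd σ → σ → σ → ℕ → Prop
  | skip (s : σ) : Exec Cmd.skip s s 0
  | op (f : σ → σ) (s : σ) : Exec (Cmd.op f) s (f s) 1
  | seq {c d : Cmd σ} {s s₁ s₂ : σ} {t₁ t₂ : ℕ} :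
      Exec c s s₁ t₁ → Exec d s₁ s₂ t₂ → Exec (Cmd.seq c d) s s₂ (t₁ + t₂)
  | read {α : Type u} {f : σ → α} {k : α → Cmd σ} {s s' : σ} {t : ℕ} :
      Exec (k (f s)) s s' t → Exec (Cmd.read f k) s s' (t + 1)
  | ite_true {b : σ → Bool} {c d : Cmd σ} {s s' : σ} {t : ℕ} :
      b s = true → Exec c s s' t → Exec (Cmd.ite b c d) s s' (t + 1)
  | ite_false {b : σ → Bool} {c d : Cmd σ} {s s' : σ} {t : ℕ} :
      b s = false → Exec d s s' t → Exec (Cmd.ite b c d) s s' (t + 1)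
  | loop_true {b : σ → Bool} {c : Cmd σ} {s s₁ s₂ : σ} {t₁ t₂ : ℕ} :
      b s = true → Exec c s s₁ t₁ → Exec (Cmd.loop b c) s₁ s₂ t₂ →
        Exec (Cmd.loop b c) s s₂ (t₁ + t₂ + 1)
  | loop_false {b : σ → Bool} {c : Cmd σ} {s : σ} :
      b s = false → Exec (Cmd.loop b c) s s 1
  | forList_nil {α : Type u} {body : α → Cmd σ} {s : σ} :
      Exec (Cmd.forList [] body) s s 0
  | forList_cons {α : Type u} {x : α} {l : List α} {body : α → Cmd σ} {s s₁ s₂ : σ} {t₁ t₂ : ℕ} :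
      Exec (body x) s s₁ t₁ → Exec (Cmd.forList l body) s₁ s₂ t₂ →
        Exec (Cmd.forList (x :: l) body) s s₂ (t₁ + t₂ + 1)

/-- Started in the memory `s`, the program `c` terminates, after at most `B` steps. -/
def RunsInTime {σ : Type u} (c : Cmd σ) (s : σ) (B : ℝ) : Prop :=
  ∃ (s' : σ) (t : ℕ), Exec c s s' t ∧ (t : ℝ) ≤ B

/-! ### Graphs -/

/-- A tree decomposition of `G`, with the nodes of the tree in `ι`. -/
structure TreeDecomposition {V : Type u} (G : SimpleGraph V) (ι : Type v) where
  /-- the tree -/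
  tree : SimpleGraph ι
  isTree : tree.IsTree
  /-- the bag of a node -/
  bag : ι → Finset V
  vertex_covered : ∀ x : V, ∃ i, x ∈ bag i
  edge_covered : ∀ x y : V, G.Adj x y → ∃ i, x ∈ bag i ∧ y ∈ bag i
  connected : ∀ x : V, (tree.induce {i | x ∈ bag i}).Connected

/-- The width of a tree decomposition: the largest size of a bag, minus one. -/
def TreeDecomposition.width {V : Type u} {G : SimpleGraph V} {ι : Type v} [Fintype ι]
    (D : TreeDecomposition G ι) : ℕ :=
  (Finset.univ.sup fun i => (D.bag i).card) - 1

/-- A representation of `G` by adjacency lists. -/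
structure AdjLists {V : Type u} (G : SimpleGraph V) where
  /-- the list of the neighbours of a vertex -/
  nbrs : V → List V
  nodup : ∀ x, (nbrs x).Nodup
  mem_nbrs : ∀ x y, y ∈ nbrs x ↔ G.Adj x y

/-- A vertex order; `π x` is the rank of `x`, and rank `0` is the highest rank. -/
abbrev VertexOrder (V : Type u) [Fintype V] : Type u := V ≃ Fin (Fintype.card V)

/-- The vertices from the highest to the lowest rank. -/
def VertexOrder.vertices {V : Type u} [Fintype V] (π : VertexOrder V) : List V :=
  (List.finRange (Fintype.card V)).map π.symm

/-! ### The memory of the labeling algorithms -/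

/-- The variables of the labeling algorithms. An entry `(h, d)` in a label of `x` stands for the
hub `h` together with the distance `d` between `h` and `x`. -/
structure Mem (V : Type u) where
  /-- the labels `L(x)` -/
  label : V → List (V × ℕ)
  /-- the new labels `δL(x)` -/
  newLabel : V → List (V × ℕ)
  /-- `inLabel x h`: look-up table for `h ∈ L(x)` -/
  inLabel : V → V → Bool
  /-- the active vertices -/
  active : List V
  /-- the messages received by a vertex -/
  msgs : V → List (V × ℕ)
  /-- the vertices with at least one message -/
  receivers : List V
  /-- array of flags (visited vertices, or hubs already met among the messages of a vertex) -/
  seen : V → Bool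
  /-- the flagged vertices, recorded in order to clear the flags -/
  trail : List V
  /-- array into which a label is mapped for a distance check; `⊤` where there is no entry -/
  dist : V → ℕ∞
  /-- the minimum computed in a distance check; `⊤` is the minimum of the empty set -/
  best : ℕ∞
  /-- the queue of a breadth-first search -/
  queue : List (V × ℕ)
  /-- `cand x h`: the bit of `h` in the candidate bit-vector `C(x)` -/
  cand : V → V → Bool
  /-- the bits `(x, h)` set in the candidate bit-vectors, recorded in order to clear them -/
  candTrail : List (V × V)
  /-- the table `H(x)` of the label of `x`; `⊤` where there is no entry -/
  table : V → V → ℕ∞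
  /-- the number of the current batch -/
  batchNo : ℕ

/-- The memory at the start: all lists are empty, no flag is set. -/
def Mem.start (V : Type u) : Mem V where
  label _ := []
  newLabel _ := []
  inLabel _ _ := false
  active := []
  msgs _ := []
  receivers := []
  seen _ := false
  trail := []
  dist _ := ⊤
  best := ⊤
  queue := []
  cand _ _ := false
  candTrail := []
  table _ _ := ⊤
  batchNo := 0

namespace Mem

variable {V : Type u} [DecidableEq V]

/-- `L(x) ← l`; used only with lists of length at most one. -/
def setLabel (x : V) (l : List (V × ℕ)) (s : Mem V) : Mem V :=
  { s with label := Function.update s.label x l }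

/-- Add the entry `e` to `L(x)`. -/
def pushLabel (x : V) (e : V × ℕ) (s : Mem V) : Mem V :=
  { s with label := Function.update s.label x (e :: s.label x) }

/-- `δL(x) ← l`; used only with lists of length at most one. -/
def setNewLabel (x : V) (l : List (V × ℕ)) (s : Mem V) : Mem V :=
  { s with newLabel := Function.update s.newLabel x l }

/-- Add the entry `e` to `δL(x)`. -/
def pushNewLabel (x : V) (e : V × ℕ) (s : Mem V) : Mem V :=
  { s with newLabel := Function.update s.newLabel x (e :: s.newLabel x) }

/-- Record `h ∈ L(x)` in the look-up table. -/
def markInLabel (x h : V) (s : Mem V) : Mem V :=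
  { s with inLabel := Function.update s.inLabel x (Function.update (s.inLabel x) h true) }

/-- Empty the list of active vertices. -/
def clearActive (s : Mem V) : Mem V := { s with active := [] }

/-- Add `x` to the active vertices. -/
def pushActive (x : V) (s : Mem V) : Mem V := { s with active := x :: s.active }

/-- Add the message `e` to the messages of `x`. -/
def pushMsg (x : V) (e : V × ℕ) (s : Mem V) : Mem V :=
  { s with msgs := Function.update s.msgs x (e :: s.msgs x) }

/-- Empty the list of messages of `x`. -/
def clearMsgs (x : V) (s : Mem V) : Mem V := { s with msgs := Function.update s.msgs x [] }

/-- Add `x` to the vertices with messages. -/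
def pushReceiver (x : V) (s : Mem V) : Mem V := { s with receivers := x :: s.receivers }

/-- Empty the list of vertices with messages. -/
def clearReceivers (s : Mem V) : Mem V := { s with receivers := [] }

/-- Set or clear the flag of `x`. -/
def setSeen (x : V) (b : Bool) (s : Mem V) : Mem V :=
  { s with seen := Function.update s.seen x b }

/-- Record that `x` is flagged. -/
def pushTrail (x : V) (s : Mem V) : Mem V := { s with trail := x :: s.trail }

/-- Empty the record of flagged vertices. -/
def clearTrail (s : Mem V) : Mem V := { s with trail := [] }

/-- Write the entry of `h` in the array for distance checks. -/
def setDist (h : V) (d : ℕ∞) (s : Mem V) : Mem V := { s with dist := Function.update s.dist h d }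

/-- Reset the minimum. -/
def resetBest (s : Mem V) : Mem V := { s with best := ⊤ }

/-- Update the minimum by a new candidate, given as a sum. -/
def updateBest (d e : Mem V → ℕ∞) (s : Mem V) : Mem V := { s with best := min s.best (d s + e s) }

/-- Append `e` to the queue. -/
def enqueue (e : V × ℕ) (s : Mem V) : Mem V := { s with queue := s.queue ++ [e] }

/-- Remove the first element of the queue. -/
def dequeue (s : Mem V) : Mem V := { s with queue := s.queue.tail }

/-- Set or clear the bit of `h` in `C(x)`. -/
def setCand (x h : V) (b : Bool) (s : Mem V) : Mem V :=
  { s with cand := Function.update s.cand x (Function.update (s.cand x) h b) }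

/-- Record that the bit of `h` is set in `C(x)`. -/
def pushCandTrail (p : V × V) (s : Mem V) : Mem V := { s with candTrail := p :: s.candTrail }

/-- Empty the record of the bits that are set. -/
def clearCandTrail (s : Mem V) : Mem V := { s with candTrail := [] }

/-- Write the entry of `h` in the table `H(x)`. -/
def setTable (x h : V) (d : ℕ∞) (s : Mem V) : Mem V :=
  { s with table := Function.update s.table x (Function.update (s.table x) h d) }

/-- Proceed to the next batch. -/
def nextBatch (s : Mem V) : Mem V := { s with batchNo := s.batchNo + 1 }

end Mem

/-! ### The algorithms -/

section Algorithms

variable {V : Type u} [Fintype V] [DecidableEq V] {G : SimpleGraph V}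

/-- Send the message `e` to `x`. -/
def send (x : V) (e : V × ℕ) : Cmd (Mem V) :=
  Cmd.when (fun s => (s.msgs x).isEmpty) (Cmd.op (Mem.pushReceiver x)) ;;
  Cmd.op (Mem.pushMsg x e)

/-- Pruned landmark labeling (PLL). -/
def pll (A : AdjLists G) (π : VertexOrder V) : Cmd (Mem V) :=
  Cmd.forList π.vertices fun u =>
    -- map `L(u)` into an array
    (Cmd.forEach (fun s => s.label u) fun e => Cmd.op (Mem.setDist e.1 e.2)) ;;
    Cmd.op (Mem.enqueue (u, 0)) ;;
    Cmd.op (Mem.setSeen u true) ;;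
    Cmd.op (Mem.pushTrail u) ;;
    (Cmd.loop (fun s => !s.queue.isEmpty) <|
      Cmd.read (fun s => s.queue.head?) fun q =>
        match q with
        | none => Cmd.skip
        | some (x, d) =>
          Cmd.op Mem.dequeue ;;
          -- distance check
          Cmd.op Mem.resetBest ;;
          (Cmd.forEach (fun s => s.label x) fun e =>
            Cmd.op (Mem.updateBest (fun s => s.dist e.1) (fun _ => e.2))) ;;
          Cmd.when (fun s => decide ((d : ℕ∞) < s.best))
            (Cmd.op (Mem.pushLabel x (u, d)) ;;
            Cmd.forList (A.nbrs x) fun y =>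
              Cmd.when (fun s => !s.seen y && decide (π u < π y))
                (Cmd.op (Mem.setSeen y true) ;;
                Cmd.op (Mem.pushTrail y) ;;
                Cmd.op (Mem.enqueue (y, d + 1))))) ;;
    -- clear the flags and the array
    (Cmd.forEach (fun s => s.trail) fun x => Cmd.op (Mem.setSeen x false)) ;;
    Cmd.op Mem.clearTrail ;;
    (Cmd.forEach (fun s => s.label u) fun e => Cmd.op (Mem.setDist e.1 ⊤))

/-- The computation of `min_{h ∈ L(u) ∩ L(x)} d(u,h) + d(h,x)` in VC-PLL: `L(u)` is mapped into an
array, `L(x)` is traversed, and the array is cleared. -/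
def vcDistanceCheck (u x : V) : Cmd (Mem V) :=
  Cmd.op Mem.resetBest ;;
  (Cmd.forEach (fun s => s.label u) fun e => Cmd.op (Mem.setDist e.1 e.2)) ;;
  (Cmd.forEach (fun s => s.label x) fun e =>
    Cmd.op (Mem.updateBest (fun s => s.dist e.1) (fun _ => e.2))) ;;
  (Cmd.forEach (fun s => s.label u) fun e => Cmd.op (Mem.setDist e.1 ⊤))

/-- The scatter phase of VC-PLL. -/
def vcScatter (A : AdjLists G) (π : VertexOrder V) : Cmd (Mem V) :=
  Cmd.forEach (fun s => s.active) fun a =>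
    Cmd.forList (A.nbrs a) fun x =>
      Cmd.forEach (fun s => s.newLabel a) fun e =>
        Cmd.when (fun s => decide (π e.1 < π x) && !s.inLabel x e.1)
          (send x (e.1, e.2 + 1))

/-- The gather phase of VC-PLL. -/
def vcGather : Cmd (Mem V) :=
  (Cmd.forEach (fun s => s.receivers) fun x =>
    Cmd.op (Mem.setNewLabel x []) ;;
    -- the flags `seen` serve to treat repeated messages only once
    (Cmd.forEach (fun s => s.msgs x) fun e =>
      Cmd.when (fun s => !s.seen e.1)
        (Cmd.op (Mem.setSeen e.1 true) ;;
        vcDistanceCheck e.1 x ;;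
        Cmd.when (fun s => decide ((e.2 : ℕ∞) < s.best)) (Cmd.op (Mem.pushNewLabel x e)))) ;;
    (Cmd.forEach (fun s => s.msgs x) fun e => Cmd.op (Mem.setSeen e.1 false)) ;;
    Cmd.op (Mem.clearMsgs x) ;;
    Cmd.when (fun s => !(s.newLabel x).isEmpty)
      ((Cmd.forEach (fun s => s.newLabel x) fun e =>
        Cmd.op (Mem.pushLabel x e) ;; Cmd.op (Mem.markInLabel x e.1)) ;;
      Cmd.op (Mem.pushActive x))) ;;
  Cmd.op Mem.clearReceivers

/-- Vertex-centric pruned landmark labeling (VC-PLL). -/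
def vcPLL (A : AdjLists G) (π : VertexOrder V) : Cmd (Mem V) :=
  (Cmd.forList π.vertices fun x =>
    Cmd.op (Mem.setNewLabel x [(x, 0)]) ;;
    Cmd.op (Mem.setLabel x [(x, 0)]) ;;
    Cmd.op (Mem.markInLabel x x) ;;
    Cmd.op (Mem.pushActive x)) ;;
  Cmd.loop (fun s => !s.active.isEmpty)
    (vcScatter A π ;; Cmd.op Mem.clearActive ;; vcGather)

/-- The batch number `i` (counted from `0`) of batch size `b`: the vertices with the ranks
`i * b, …, (i + 1) * b - 1`. -/
def batch (π : VertexOrder V) (b i : ℕ) : List V :=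
  (π.vertices.drop (i * b)).take b

/-- The scatter phase of BVC-PLL. -/
def bvcScatter (A : AdjLists G) (π : VertexOrder V) : Cmd (Mem V) :=
  Cmd.forEach (fun s => s.active) fun a =>
    Cmd.forList (A.nbrs a) fun x =>
      Cmd.forEach (fun s => s.newLabel a) fun e =>
        Cmd.when (fun s => decide (π e.1 < π x) && !s.cand x e.1)
          (Cmd.op (Mem.setCand x e.1 true) ;;
          Cmd.op (Mem.pushCandTrail (x, e.1)) ;;
          send x (e.1, e.2 + 1))

/-- The gather phase of BVC-PLL with batch size `b`. -/
def bvcGather (π : VertexOrder V) (b : ℕ) : Cmd (Mem V) :=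
  (Cmd.forEach (fun s => s.receivers) fun x =>
    Cmd.op (Mem.setNewLabel x []) ;;
    (Cmd.forEach (fun s => s.msgs x) fun e =>
      -- distance check
      Cmd.op Mem.resetBest ;;
      (Cmd.forEach (fun s => s.label x) fun f =>
        Cmd.op (Mem.updateBest (fun s => s.table e.1 f.1) (fun _ => f.2))) ;;
      Cmd.when (fun s => decide ((e.2 : ℕ∞) < s.best)) (Cmd.op (Mem.pushNewLabel x e))) ;;
    Cmd.op (Mem.clearMsgs x) ;;
    Cmd.when (fun s => !(s.newLabel x).isEmpty)
      ((Cmd.forEach (fun s => s.newLabel x) fun e => Cmd.op (Mem.pushLabel x e)) ;;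
      Cmd.op (Mem.pushActive x)) ;;
    -- if `x` lies in the current batch, then `H(x)` is updated
    Cmd.when (fun s => decide ((π x : ℕ) / b = s.batchNo))
      (Cmd.forEach (fun s => s.newLabel x) fun e => Cmd.op (Mem.setTable x e.1 e.2))) ;;
  Cmd.op Mem.clearReceivers

/-- Batched vertex-centric pruned landmark labeling (BVC-PLL) with batch size `b`; the last batch
may be smaller. -/
def bvcPLL (A : AdjLists G) (π : VertexOrder V) (b : ℕ) : Cmd (Mem V) :=
  (Cmd.forList π.vertices fun x => Cmd.op (Mem.setLabel x [])) ;;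
  Cmd.loop (fun s => decide (s.batchNo * b < Fintype.card V))
    ((Cmd.forEach (fun s => batch π b s.batchNo) fun u =>
      Cmd.op (Mem.setNewLabel u [(u, 0)]) ;;
      Cmd.op (Mem.pushLabel u (u, 0)) ;;
      (Cmd.forEach (fun s => s.label u) fun e => Cmd.op (Mem.setTable u e.1 e.2)) ;;
      Cmd.op (Mem.pushActive u)) ;;
    Cmd.loop (fun s => !s.active.isEmpty)
      (bvcScatter A π ;; Cmd.op Mem.clearActive ;; bvcGather π b) ;;
    -- clear the candidate bit-vectors
    (Cmd.forEach (fun s => s.candTrail) fun p => Cmd.op (Mem.setCand p.1 p.2 false)) ;;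
    Cmd.op Mem.clearCandTrail ;;
    Cmd.op Mem.nextBatch)

end Algorithms

/-- The bound `w |E| log |V| + w² |V| (log |V|)²`. -/
def treewidthBound {V : Type u} [Fintype V] (G : SimpleGraph V) (w : ℕ) : ℝ :=
  (w : ℝ) * (G.edgeSet.ncard : ℝ) * Real.log (Fintype.card V) +
    (w : ℝ) ^ 2 * (Fintype.card V : ℝ) * (Real.log (Fintype.card V)) ^ 2

end

/-! ### Weakest preconditions with time -/

/-! One number governs all three running times. Say that `u` reaches `x` if some walk from `u` to
`x` has all its vertices after `u` ranked below `u`. A hub `u` can enter the label of `x` only along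
such a walk. Suppose that every `x` is reached by at most `K` vertices. Then labels have at most `K`
entries, a distance check costs O(K), and at most `K |V|` pairs `(u, x)` matter. If each pair causes
boundedly many distance checks and one scan of the neighbours of `x`, the total is O(K² |V| + K
|E|).

The order. Some bag of the decomposition splits a given vertex set into components of at most half
its size (`TreeDecomposition.exists_separator`). Removing such a bag from every component, in
parallel, exhausts `V` after log₂ |V| + 1 rounds, and vertices are ranked by the round of their
removal. If `u` reaches `x`, both lie in the same component when `u` is removed, so `u` belongs to
the bag removed from the component of `x` in that round. Hence `K = (w + 1)(log₂ |V| + 1)` works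
(`TreeDecomposition.exists_order`).

The algorithms. In PLL the visited flags, and in BVC-PLL the candidate bits, allow each pair at most
one distance check beyond the roots, whatever the checks answer; the correctness of the labels plays
no role. VC-PLL only tests whether `u` is already a hub of `x`, so a rejected pair may come back in
a later round. There exactness is needed: after `k` rounds all labels hold true distances at most
`k`, and they contain every canonical hub within distance `k` (`VcInv`, `VcMid.of_check`). A message
about `u` sent to `x` in round `k + 1` therefore comes from a neighbour of `x` at distance exactly
`k` from `u`, so the distance of `u` and `x` differs from `k` by at most one, and the pair is
checked in at most three rounds.

Time is counted with potentials: the invariants have the form "time spent plus outstanding charges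
is at most `N`". As every round of a loop costs time, this also yields termination. -/

/-- Started in `s`, the program `c` terminates, and the final memory and the number of steps
satisfy `Q`. -/
def WP {σ : Type u} (c : Cmd σ) (s : σ) (Q : σ → ℕ → Prop) : Prop :=
  ∃ s' t, Exec c s s' t ∧ Q s' t

namespace WP

variable {σ : Type u} {α : Type u} {c d : Cmd σ} {s : σ} {Q Q' : σ → ℕ → Prop}

theorem mono (h : WP c s Q) (hQ : ∀ s' t, Q s' t → Q' s' t) : WP c s Q' := by
  obtain ⟨s', t, he, hq⟩ := h
  exact ⟨s', t, he, hQ _ _ hq⟩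

theorem skip (h : Q s 0) : WP Cmd.skip s Q := ⟨_, _, Exec.skip s, h⟩

theorem op {f : σ → σ} (h : Q (f s) 1) : WP (Cmd.op f) s Q := ⟨_, _, Exec.op f s, h⟩

theorem seq (h : WP c s fun s₁ t₁ => WP d s₁ fun s₂ t₂ => Q s₂ (t₁ + t₂)) :
    WP (Cmd.seq c d) s Q := by
  obtain ⟨s₁, t₁, h₁, s₂, t₂, h₂, hq⟩ := h
  exact ⟨_, _, Exec.seq h₁ h₂, hq⟩

theorem read {f : σ → α} {k : α → Cmd σ} (h : WP (k (f s)) s fun s' t => Q s' (t + 1)) :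
    WP (Cmd.read f k) s Q := by
  obtain ⟨s₁, t₁, h₁, hq⟩ := h
  exact ⟨_, _, Exec.read h₁, hq⟩

theorem ite {b : σ → Bool} (h₁ : b s = true → WP c s fun s' t => Q s' (t + 1))
    (h₂ : b s = false → WP d s fun s' t => Q s' (t + 1)) : WP (Cmd.ite b c d) s Q := by
  cases hb : b s with
  | true =>
    obtain ⟨s₁, t₁, he, hq⟩ := h₁ hb
    exact ⟨_, _, Exec.ite_true hb he, hq⟩
  | false =>
    obtain ⟨s₁, t₁, he, hq⟩ := h₂ hb
    exact ⟨_, _, Exec.ite_false hb he, hq⟩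

theorem when {b : σ → Bool} (h₁ : b s = true → WP c s fun s' t => Q s' (t + 1))
    (h₂ : b s = false → Q s 1) : WP (Cmd.when b c) s Q :=
  ite h₁ fun hb => skip (h₂ hb)

/-- The list traversal rule: the invariant speaks about the rest of the list, the memory and the
time spent so far. -/
theorem forList {body : α → Cmd σ} (I : List α → σ → ℕ → Prop)
    (hI : ∀ x l s t, I (x :: l) s t → WP (body x) s fun s' t' => I l s' (t + t' + 1)) :
    ∀ (l : List α) (s : σ) (t : ℕ), I l s t →
      WP (Cmd.forList l body) s fun s' t' => I [] s' (t + t') := by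
  intro l
  induction l with
  | nil => exact fun s t h => ⟨_, _, Exec.forList_nil, h⟩
  | cons x l ih =>
    intro s t h
    obtain ⟨s₁, t₁, h₁, hq₁⟩ := hI _ _ _ _ h
    obtain ⟨s₂, t₂, h₂, hq₂⟩ := ih _ _ hq₁
    refine ⟨_, _, Exec.forList_cons h₁ h₂, ?_⟩
    have : t + (t₁ + t₂ + 1) = t + t₁ + 1 + t₂ := by omega
    beta_reduce
    rwa [this]

/-- Traversal of a list with an elementary instruction for each entry. -/
theorem forList_op {f : α → σ → σ} (l : List α)
    (h : Q (l.foldl (fun s e => f e s) s) (2 * l.length)) :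
    WP (Cmd.forList l fun e => Cmd.op (f e)) s Q := by
  have key : ∀ (l : List α) (s : σ), Exec (Cmd.forList l fun e => Cmd.op (f e)) s
      (l.foldl (fun s e => f e s) s) (2 * l.length) := by
    intro l
    induction l with
    | nil => exact fun s => Exec.forList_nil
    | cons x l ih =>
      intro s
      have := Exec.forList_cons (body := fun e => Cmd.op (f e)) (Exec.op (f x) s) (ih (f x s))
      have e : 1 + 2 * l.length + 1 = 2 * (x :: l).length := by simp; omega
      rwa [e] at this
  exact ⟨_, _, key l s, h⟩

theorem forEach_op {g : σ → List α} {f : α → σ → σ}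
    (h : Q ((g s).foldl (fun s e => f e s) s) (2 * (g s).length + 1)) :
    WP (Cmd.forEach g fun e => Cmd.op (f e)) s Q :=
  read (forList_op _ h)

/-- The loop rule: as every round costs time, a bound on the time ensures termination. -/
theorem loop {b : σ → Bool} (N : ℕ) (I : σ → ℕ → Prop) (hN : ∀ s t, I s t → t ≤ N)
    (hI : ∀ s t, I s t → b s = true → WP c s fun s' t' => I s' (t + t' + 1)) :
    ∀ (s : σ) (t : ℕ), I s t →
      WP (Cmd.loop b c) s fun s' t' => b s' = false ∧ ∃ t₀, t' = t₀ + 1 ∧ I s' (t + t₀) := by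
  -- Induction on the remaining budget `N - t`: the step spent on the test makes it drop in every
  -- round.
  suffices ∀ (m : ℕ) (s : σ) (t : ℕ), N - t < m → I s t →
      WP (Cmd.loop b c) s fun s' t' => b s' = false ∧ ∃ t₀, t' = t₀ + 1 ∧ I s' (t + t₀) from
    fun s t => this (N - t + 1) s t (by omega)
  intro m
  induction m with
  | zero => intro s t h; omega
  | succ m ih =>
    intro s t hm h
    cases hb : b s with
    | false => exact ⟨_, _, Exec.loop_false hb, hb, 0, rfl, h⟩
    | true =>
      obtain ⟨s₁, t₁, h₁, hq₁⟩ := hI _ _ h hb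
      have := hN _ _ hq₁
      obtain ⟨s₂, t₂, h₂, hb₂, t₀, rfl, hq₂⟩ := ih s₁ (t + t₁ + 1) (by omega) hq₁
      refine ⟨_, _, Exec.loop_true hb h₁ h₂, hb₂, t₁ + t₀ + 1, by omega, ?_⟩
      have : t + (t₁ + t₀ + 1) = t + t₁ + 1 + t₀ := by omega
      rwa [this]

theorem runsInTime {B : ℝ} (h : WP c s fun _ t => (t : ℝ) ≤ B) : RunsInTime c s B := h

end WP

/-! ### Vertex orders from tree decompositions -/

namespace SimpleGraph

variable {ι : Type v} (T : SimpleGraph ι)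

/-- `k` lies on the side of `j` when the edge from `i` to `j` is removed. -/
def OnSide (i j k : ι) : Prop := (T.deleteEdges {s(i, j)}).Reachable j k

variable {T}

theorem OnSide.step {i j k k' : ι} (h : T.OnSide i j k) (ha : T.Adj k k') (hk : k ≠ i)
    (hk' : k' ≠ i) : T.OnSide i j k' := by
  refine h.trans (Adj.reachable ?_)
  rw [deleteEdges_adj]
  refine ⟨ha, ?_⟩
  simp only [Set.mem_singleton_iff, Sym2.eq_iff]
  tauto

/-- Take the first edge of a path from `i` to `k`; the rest of the path does not return to `i`, so
it avoids that edge. -/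
theorem IsTree.exists_onSide (hT : T.IsTree) {i k : ι} (h : k ≠ i) :
    ∃ j, T.Adj i j ∧ T.OnSide i j k := by
  classical
  obtain ⟨p, hp⟩ := (hT.connected.preconnected i k).exists_isPath
  cases p with
  | nil => exact absurd rfl h
  | @cons _ j _ ha p =>
    rw [Walk.cons_isPath_iff] at hp
    refine ⟨j, ha, ?_⟩
    refine (p.toDeleteEdges {s(i, j)} ?_).reachable
    rintro e he rfl
    exact hp.2 (p.fst_mem_support_of_mem_edges he)

/-- Every edge of a tree is a bridge, so after its deletion no node is connected to both ends. -/
theorem IsTree.not_onSide (hT : T.IsTree) {i j k : ι} (ha : T.Adj i j) (h : T.OnSide i j k)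
    (h' : T.OnSide j i k) : False := by
  have hb := isAcyclic_iff_forall_isBridge.1 hT.isAcyclic ((mem_edgeSet T).2 ha)
  rw [isBridge_iff] at hb
  unfold OnSide at h h'
  rw [Sym2.eq_swap] at h'
  exact hb (h'.trans h.symm)

end SimpleGraph

/-! ### Balanced separators among the bags -/

section Separator

variable {V : Type u} [Fintype V] (G : SimpleGraph V)

/-- The vertices that are connected to `x` by a walk within `S` (apart from `x` itself). -/
noncomputable def comp (S : Finset V) (x : V) : Finset V :=
  open Classical in {y | Relation.ReflTransGen (fun a b => G.Adj a b ∧ a ∈ S ∧ b ∈ S) x y}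

variable {G}

theorem mem_comp {S : Finset V} {x y : V} : y ∈ comp G S x ↔
    Relation.ReflTransGen (fun a b => G.Adj a b ∧ a ∈ S ∧ b ∈ S) x y := by
  simp [comp]

theorem mem_comp_symm {S : Finset V} {x y : V} (h : y ∈ comp G S x) : x ∈ comp G S y := by
  rw [mem_comp] at *
  induction h with
  | refl => exact .refl
  | tail _ h ih => exact .head ⟨h.1.symm, h.2.2, h.2.1⟩ ih

theorem comp_subset {S : Finset V} {x : V} (hx : x ∈ S) : comp G S x ⊆ S := by
  intro y hy
  rw [mem_comp] at hy
  cases hy with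
  | refl => exact hx
  | tail _ h => exact h.2.2

theorem comp_eq {S : Finset V} {x y : V} (h : y ∈ comp G S x) : comp G S y = comp G S x := by
  have h' := mem_comp_symm h
  ext z
  rw [mem_comp] at *
  rw [mem_comp]
  exact ⟨fun hz => h.trans hz, fun hz => h'.trans hz⟩

/-- The nodes whose bags contain a vertex outside `bag i` form a subtree avoiding `i`, so they lie
on one side. Adjacent vertices share a bag, so the side stays the same along a walk within `S`. -/
theorem TreeDecomposition.onSide_of_mem_comp {ι : Type v} (D : TreeDecomposition G ι) {S : Finset V}
    {i j : ι} {x : V} (hS : ∀ y ∈ S, y ∉ D.bag i) (hx : x ∈ S) {k : ι} (hk : x ∈ D.bag k)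
    (h : D.tree.OnSide i j k) {y : V} (hy : y ∈ comp G S x) :
    ∀ l, y ∈ D.bag l → D.tree.OnSide i j l := by
  have key : ∀ z ∈ S, ∀ m, z ∈ D.bag m → D.tree.OnSide i j m →
      ∀ l, z ∈ D.bag l → D.tree.OnSide i j l := by
    intro z hz m hm hs l hl
    obtain ⟨p⟩ := (D.connected z).preconnected ⟨m, hm⟩ ⟨l, hl⟩
    suffices ∀ (a b : {i | z ∈ D.bag i}) (p : (D.tree.induce {i | z ∈ D.bag i}).Walk a b),
        D.tree.OnSide i j a → D.tree.OnSide i j b from this _ _ p hs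
    intro a b p
    induction p with
    | nil => exact id
    | @cons a b c ha p ih =>
      intro h
      refine ih (h.step ha ?_ ?_)
      · rintro h'
        exact hS z hz (h' ▸ a.2)
      · rintro h'
        exact hS z hz (h' ▸ b.2)
  rw [mem_comp] at hy
  induction hy with
  | refl => exact key x hx k hk h
  | @tail b c _ hbc ih =>
    obtain ⟨m, hm, hm'⟩ := D.edge_covered b c hbc.1
    exact key c hbc.2.2 m hm' (ih m hm)

variable [DecidableEq V]

/-- Some bag splits `S` into components of at most half the size. -/
theorem TreeDecomposition.exists_separator {ι : Type v} [Fintype ι] (D : TreeDecomposition G ι)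
    (S : Finset V) :
    ∃ i, ∀ x ∈ S \ D.bag i, 2 * (comp G (S \ D.bag i) x).card ≤ S.card := by
  classical
  by_contra! hcon
  choose x hx hlt using hcon
  have hS : ∀ i, ∀ y ∈ S \ D.bag i, y ∉ D.bag i := fun i y hy => (Finset.mem_sdiff.1 hy).2
  choose k hk using D.vertex_covered
  have hne : ∀ i, k (x i) ≠ i := by
    intro i h
    have := hk (x i)
    rw [h] at this
    exact hS i _ (hx i) this
  choose f hf hside using fun i => D.isTree.exists_onSide (hne i)
  have hcard := D.isTree.card_edgeFinset
  -- Every node `i` points along a tree edge towards its too large component. A tree has fewer edges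
  -- than nodes, so two nodes choose the same edge and point at each other.
  obtain ⟨i, -, i', -, hii, he⟩ := Finset.exists_ne_map_eq_of_card_lt_of_maps_to
    (s := (Finset.univ : Finset ι)) (t := D.tree.edgeFinset) (f := fun i => s(i, f i))
    (by rw [Finset.card_univ]; omega) (fun i _ => by simpa using hf i)
  have hi : f i = i' ∧ f i' = i := by
    simp only [Sym2.eq_iff] at he
    tauto
  have hsub : ∀ i, comp G (S \ D.bag i) (x i) ⊆ S := fun i =>
    (comp_subset (hx i)).trans Finset.sdiff_subset
  -- Each of the two components fills more than half of `S`, so they meet; the bags of a common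
  -- vertex would have to lie on both sides of the edge.
  have hint : (comp G (S \ D.bag i) (x i) ∩ comp G (S \ D.bag i') (x i')).Nonempty := by
    refine Finset.inter_nonempty_of_card_lt_card_add_card (hsub i) (hsub i') ?_
    have := hlt i
    have := hlt i'
    omega
  obtain ⟨y, hy⟩ := hint
  rw [Finset.mem_inter] at hy
  have h₁ := D.onSide_of_mem_comp (hS i) (hx i) (hk _) (hside i) hy.1 _ (hk y)
  have h₂ := D.onSide_of_mem_comp (hS i') (hx i') (hk _) (hside i') hy.2 _ (hk y)
  rw [hi.1] at h₁
  rw [hi.2] at h₂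
  exact D.isTree.not_onSide (hi.1 ▸ hf i) h₁ h₂

/-- What remains of `V` after `j` rounds, each of which removes a separator from every component. -/
noncomputable def remaining (G : SimpleGraph V) (sep : Finset V → Finset V) : ℕ → Finset V
  | 0 => Finset.univ
  | j + 1 => (remaining G sep j).filter fun x => x ∉ sep (comp G (remaining G sep j) x)

theorem remaining_anti (sep : Finset V → Finset V) : Antitone (remaining G sep) :=
  antitone_nat_of_succ_le fun _ => Finset.filter_subset _ _

/-- Each round halves the components: a component after round `j + 1` lies in some component of `S \
sep S`, where `S` is the component it came from. -/
theorem card_comp_remaining {sep : Finset V → Finset V}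
    (hsep : ∀ S, ∀ x ∈ S \ sep S, 2 * (comp G (S \ sep S) x).card ≤ S.card) (j : ℕ) :
    ∀ x ∈ remaining G sep j, 2 ^ j * (comp G (remaining G sep j) x).card ≤ Fintype.card V := by
  induction j with
  | zero => intro x _; simpa using Finset.card_le_univ _
  | succ j ih =>
    intro x hx
    rw [remaining, Finset.mem_filter] at hx
    set S := comp G (remaining G sep j) x with hS
    have hxS : x ∈ S := mem_comp.2 .refl
    have hsub : comp G (remaining G sep (j + 1)) x ⊆ comp G (S \ sep S) x := by
      intro y hy
      rw [mem_comp] at hy ⊢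
      induction hy with
      | refl => exact .refl
      | @tail b c hab hbc ih =>
        refine ih.tail ⟨hbc.1, ?_⟩
        have hb : b ∈ S := by
          rw [hS, mem_comp]
          refine Relation.ReflTransGen.mono ?_ _ _ hab
          exact fun a b h => ⟨h.1, remaining_anti sep j.le_succ h.2.1,
            remaining_anti sep j.le_succ h.2.2⟩
        have hc : c ∈ S := by
          rw [hS, mem_comp] at hb ⊢
          exact hb.tail ⟨hbc.1, remaining_anti sep j.le_succ hbc.2.1,
            remaining_anti sep j.le_succ hbc.2.2⟩
        have h₁ := hbc.2.1
        have h₂ := hbc.2.2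
        rw [remaining, Finset.mem_filter] at h₁ h₂
        rw [comp_eq hb, ← hS] at h₁
        rw [comp_eq hc, ← hS] at h₂
        exact ⟨Finset.mem_sdiff.2 ⟨hb, h₁.2⟩, Finset.mem_sdiff.2 ⟨hc, h₂.2⟩⟩
    have h₁ := Finset.card_le_card hsub
    have h₂ := hsep S x (Finset.mem_sdiff.2 ⟨hxS, hx.2⟩)
    have h₃ := ih x hx.1
    calc 2 ^ (j + 1) * (comp G (remaining G sep (j + 1)) x).card
        ≤ 2 ^ (j + 1) * (comp G (S \ sep S) x).card := by gcongr
      _ = 2 ^ j * (2 * (comp G (S \ sep S) x).card) := by ring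
      _ ≤ 2 ^ j * S.card := by gcongr
      _ ≤ _ := h₃

end Separator

/-- A vertex order sorting the vertices by a level. -/
theorem exists_vertexOrder_of_level {V : Type u} [Fintype V] (lvl : V → ℕ) :
    ∃ π : VertexOrder V, ∀ x y, π x ≤ π y → lvl x ≤ lvl y := by
  let e := Fintype.equivFin V
  let p := Tuple.sort (lvl ∘ e.symm)
  refine ⟨e.trans p.symm, fun x y h => ?_⟩
  have := Tuple.monotone_sort (lvl ∘ e.symm) h
  simpa [p] using this

/-! ### Few vertices reach a given vertex -/

section Reach

variable {V : Type u} [Fintype V]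

/-- The vertex `u` reaches `x` through vertices of lower rank. -/
def Reach (G : SimpleGraph V) (π : VertexOrder V) : V → V → Prop := fun u =>
  Relation.ReflTransGen (fun a b => G.Adj a b ∧ π u < π b) u

/-- The vertices that reach `x`. -/
noncomputable def reaching (G : SimpleGraph V) (π : VertexOrder V) (x : V) : Finset V :=
  open Classical in {u | Reach G π u x}

variable {G : SimpleGraph V} {π : VertexOrder V}

theorem mem_reaching {u x : V} : u ∈ reaching G π x ↔ Reach G π u x := by simp [reaching]

theorem Reach.le {u x : V} (h : Reach G π u x) : π u ≤ π x := by
  cases h with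
  | refl => exact le_rfl
  | tail _ h => exact h.2.le

theorem Reach.reachable {u x : V} (h : Reach G π u x) : G.Reachable u x := by
  induction h with
  | refl => exact .rfl
  | tail _ h ih => exact ih.trans h.1.reachable

/-- A walk witnessing that `u` reaches `x` visits only vertices removed no earlier than `u`. So `u`
and `x` share a component when `u` is removed, and `u` lies in the bag chosen for the component of
`x`. There is one such bag per round. -/
theorem TreeDecomposition.exists_order {ι : Type v} [Fintype ι] (D : TreeDecomposition G ι) :
    ∃ π : VertexOrder V, ∀ x,
      (reaching G π x).card ≤ (D.width + 1) * (Nat.log 2 (Fintype.card V) + 1) := by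
  classical
  choose i hi using D.exists_separator
  set sep : Finset V → Finset V := fun S => D.bag (i S)
  set n := Fintype.card V
  -- A vertex surviving all these rounds would force `2 ^ (Nat.log 2 n + 1) ≤ n`.
  have hlast : remaining G sep (Nat.log 2 n + 1) = ∅ := by
    rw [Finset.eq_empty_iff_forall_notMem]
    intro x hx
    have h₁ := card_comp_remaining (G := G) (sep := sep) hi _ x hx
    have h₂ : 0 < (comp G (remaining G sep (Nat.log 2 n + 1)) x).card :=
      Finset.card_pos.2 ⟨x, mem_comp.2 .refl⟩
    have h₃ := Nat.lt_pow_succ_log_self one_lt_two n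
    have : 2 ^ (Nat.log 2 n + 1) * 1 ≤ n := le_trans (Nat.mul_le_mul_left _ h₂) h₁
    rw [Nat.succ_eq_add_one] at h₃
    omega
  have hex : ∀ x, ∃ j, x ∉ remaining G sep (j + 1) := fun x =>
    ⟨Nat.log 2 n, by rw [hlast]; simp⟩
  set lvl : V → ℕ := fun x => Nat.find (hex x) with hlvl
  have hmem : ∀ x j, j ≤ lvl x → x ∈ remaining G sep j := by
    intro x j hj
    cases j with
    | zero => simp [remaining]
    | succ j => exact not_not.1 (Nat.find_min (hex x) hj)
  have hnot : ∀ x, x ∉ remaining G sep (lvl x + 1) := fun x => Nat.find_spec (hex x)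
  have hle : ∀ x, lvl x ≤ Nat.log 2 n := fun x =>
    Nat.find_min' (hex x) (by rw [hlast]; simp)
  obtain ⟨π, hπ⟩ := exists_vertexOrder_of_level lvl
  refine ⟨π, fun x => ?_⟩
  have hsub : reaching G π x ⊆ (Finset.range (Nat.log 2 n + 1)).biUnion fun j =>
      sep (comp G (remaining G sep j) x) := by
    intro u hu
    rw [mem_reaching] at hu
    rw [Finset.mem_biUnion]
    refine ⟨lvl u, Finset.mem_range.2 (Nat.lt_succ_of_le (hle u)), ?_⟩
    have hc : x ∈ comp G (remaining G sep (lvl u)) u := by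
      rw [mem_comp]
      induction hu with
      | refl => exact .refl
      | @tail b c hab hbc ih =>
        exact ih.tail ⟨hbc.1, hmem _ _ (hπ _ _ (Reach.le hab)), hmem _ _ (hπ _ _ hbc.2.le)⟩
    rw [comp_eq hc]
    have h₁ := hnot u
    rw [remaining, Finset.mem_filter] at h₁
    by_contra h₂
    exact h₁ ⟨hmem u _ le_rfl, h₂⟩
  refine (Finset.card_le_card hsub).trans ((Finset.card_biUnion_le_card_mul _ _
    (D.width + 1) fun j _ => ?_).trans ?_)
  -- The truncated subtraction in `width` is harmless here: a bag has at most `width + 1` elements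
  -- even if all bags are empty.
  · have : (D.bag (i (comp G (remaining G sep j) x))).card ≤
        Finset.univ.sup fun i => (D.bag i).card :=
      Finset.le_sup (f := fun i => (D.bag i).card) (Finset.mem_univ _)
    rw [TreeDecomposition.width]
    change (D.bag (i (comp G (remaining G sep j) x))).card ≤ _
    omega
  · rw [Finset.card_range, mul_comm]

end Reach

/-! ### Labels -/

section Hubs

variable {V : Type u}

/-- The hubs of a list of label entries. -/
def hubs (l : List (V × ℕ)) : List V := l.map Prod.fst

@[simp] theorem hubs_nil : hubs ([] : List (V × ℕ)) = [] := rfl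

@[simp] theorem hubs_cons (e : V × ℕ) (l : List (V × ℕ)) : hubs (e :: l) = e.1 :: hubs l := rfl

@[simp] theorem hubs_append (l l' : List (V × ℕ)) : hubs (l ++ l') = hubs l ++ hubs l' :=
  List.map_append

@[simp] theorem hubs_reverse (l : List (V × ℕ)) : hubs l.reverse = (hubs l).reverse :=
  List.map_reverse

@[simp] theorem length_hubs (l : List (V × ℕ)) : (hubs l).length = l.length := List.length_map _

theorem mem_hubs {l : List (V × ℕ)} {h : V} : h ∈ hubs l ↔ ∃ d, (h, d) ∈ l := by simp [hubs]

theorem mem_hubs_of_mem {l : List (V × ℕ)} {e : V × ℕ} (h : e ∈ l) : e.1 ∈ hubs l :=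
  List.mem_map_of_mem h

end Hubs

/-! ### Label sizes, double counting and changes of potentials -/

section Common

variable {V : Type u} [Fintype V]

/-- No hub occurs twice in a label, and a label contains only hubs that reach its vertex. -/
def LabelOK (G : SimpleGraph V) (π : VertexOrder V) (L : V → List (V × ℕ)) : Prop :=
  ∀ x, (hubs (L x)).Nodup ∧ ∀ h ∈ hubs (L x), Reach G π h x

variable {G : SimpleGraph V} {π : VertexOrder V} {K : ℕ}

theorem length_le_of_hubs {l : List (V × ℕ)} {x : V} (hK : (reaching G π x).card ≤ K)
    (h₁ : (hubs l).Nodup) (h₂ : ∀ h ∈ hubs l, Reach G π h x) : l.length ≤ K := by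
  classical
  rw [← length_hubs, ← List.toFinset_card_of_nodup h₁]
  refine (Finset.card_le_card fun h hh => ?_).trans hK
  exact mem_reaching.2 (h₂ h (List.mem_toFinset.1 hh))

theorem LabelOK.length_le {L : V → List (V × ℕ)} (h : LabelOK G π L)
    (hK : ∀ x, (reaching G π x).card ≤ K) (x : V) : (L x).length ≤ K :=
  length_le_of_hubs (hK x) (h x).1 (h x).2

theorem one_le_of_card_reaching (hK : ∀ x, (reaching G π x).card ≤ K) (x : V) : 1 ≤ K :=
  le_trans (Finset.card_pos.2 ⟨x, mem_reaching.2 .refl⟩) (hK x)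

/-- The vertices that `u` reaches. -/
noncomputable def reached (G : SimpleGraph V) (π : VertexOrder V) (u : V) : Finset V :=
  open Classical in {x | Reach G π u x}

theorem mem_reached {u x : V} : x ∈ reached G π u ↔ Reach G π u x := by simp [reached]

theorem sum_reached (f : V → V → ℕ) :
    ∑ u, ∑ x ∈ reached G π u, f u x = ∑ x, ∑ u ∈ reaching G π x, f u x :=
  Finset.sum_comm' (by simp [mem_reached, mem_reaching])

/-- After exchanging the sums, `f x` is counted once for each of the at most `K` vertices reaching
`x`. -/
theorem sum_reached_le (hK : ∀ x, (reaching G π x).card ≤ K) (f : V → ℕ) :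
    ∑ u, ∑ x ∈ reached G π u, f x ≤ K * ∑ x, f x := by
  rw [sum_reached, Finset.mul_sum]
  refine Finset.sum_le_sum fun x _ => ?_
  rw [Finset.sum_const, smul_eq_mul]
  exact Nat.mul_le_mul_right _ (hK x)

/-- Bookkeeping for potentials: an elementary event changes the summand at a single index `a` and
releases the charge `c` there. -/
theorem sum_add_le_sum {α : Type*} {S : Finset α} {f g : α → ℕ} {a : α} {c : ℕ} (ha : a ∈ S)
    (hc : f a + c ≤ g a) (h : ∀ b ∈ S, b ≠ a → f b ≤ g b) : ∑ b ∈ S, f b + c ≤ ∑ b ∈ S, g b := by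
  classical
  rw [← Finset.add_sum_erase S f ha, ← Finset.add_sum_erase S g ha]
  have := Finset.sum_le_sum (s := S.erase a) (f := f) (g := g) fun b hb =>
    h b (Finset.mem_of_mem_erase hb) (Finset.ne_of_mem_erase hb)
  omega

theorem sum_le_sum_add {α : Type*} {S : Finset α} {f g : α → ℕ} {a : α} {c : ℕ} (ha : a ∈ S)
    (hc : f a ≤ g a + c) (h : ∀ b ∈ S, b ≠ a → f b ≤ g b) :
    ∑ b ∈ S, f b ≤ ∑ b ∈ S, g b + c := by
  classical
  rw [← Finset.add_sum_erase S f ha, ← Finset.add_sum_erase S g ha]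
  have := Finset.sum_le_sum (s := S.erase a) (f := f) (g := g) fun b hb =>
    h b (Finset.mem_of_mem_erase hb) (Finset.ne_of_mem_erase hb)
  omega

/-- The pairs `(u, x)` such that `u` reaches `x`. -/
noncomputable def reachPairs (G : SimpleGraph V) (π : VertexOrder V) : Finset (V × V) :=
  open Classical in {p | Reach G π p.1 p.2}

theorem mem_reachPairs {u x : V} : (u, x) ∈ reachPairs G π ↔ Reach G π u x := by
  simp [reachPairs]

theorem sum_reachPairs (f : V × V → ℕ) :
    ∑ p ∈ reachPairs G π, f p = ∑ x, ∑ u ∈ reaching G π x, f (u, x) :=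
  Finset.sum_finset_product_right _ _ _ (by simp [reachPairs, mem_reaching])

theorem sum_reachPairs_le (hK : ∀ x, (reaching G π x).card ≤ K) (f : V → ℕ) :
    ∑ p ∈ reachPairs G π, f p.2 ≤ K * ∑ x, f x := by
  rw [sum_reachPairs, Finset.mul_sum]
  refine Finset.sum_le_sum fun x _ => ?_
  change ∑ u ∈ reaching G π x, f x ≤ _
  rw [Finset.sum_const, smul_eq_mul]
  exact Nat.mul_le_mul_right _ (hK x)

theorem VertexOrder.mem_vertices (π : VertexOrder V) (x : V) : x ∈ π.vertices := by
  rw [VertexOrder.vertices, List.mem_map]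
  exact ⟨π x, List.mem_finRange _, π.symm_apply_apply x⟩

theorem VertexOrder.nodup_vertices (π : VertexOrder V) : π.vertices.Nodup :=
  (List.nodup_finRange _).map π.symm.injective

theorem VertexOrder.length_vertices (π : VertexOrder V) :
    π.vertices.length = Fintype.card V := by simp [VertexOrder.vertices]

theorem VertexOrder.sum_vertices (π : VertexOrder V) (f : V → ℕ) :
    (π.vertices.map f).sum = ∑ x, f x := by
  classical
  rw [← List.sum_toFinset f π.nodup_vertices]
  exact congrArg (fun S => ∑ x ∈ S, f x)
    (Finset.eq_univ_iff_forall.2 fun x => List.mem_toFinset.2 (π.mem_vertices x))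

/-- The total length of the adjacency lists. -/
def AdjLists.size (A : AdjLists G) : ℕ := ∑ x, (A.nbrs x).length

end Common

/-! ### Messages and their receivers -/

section Mailbox

variable {V : Type u}

/-- The list `r` contains the vertices with messages, each of them once. -/
structure Mailbox (r : List V) (m : V → List (V × ℕ)) : Prop where
  nodup : r.Nodup
  mem : ∀ x, x ∈ r ↔ m x ≠ []

theorem Mailbox.empty {m : V → List (V × ℕ)} (h : ∀ x, m x = []) : Mailbox [] m :=
  ⟨List.nodup_nil, fun x => by simp [h x]⟩

theorem Mailbox.eq_nil {m : V → List (V × ℕ)} (h : Mailbox [] m) (x : V) : m x = [] := by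
  by_contra hx
  simpa using (h.mem x).2 hx

variable [DecidableEq V]

/-- The effect of sending a message. -/
def Mem.deliver (x : V) (e : V × ℕ) (s : Mem V) : Mem V :=
  { s with
    receivers := if (s.msgs x).isEmpty then x :: s.receivers else s.receivers
    msgs := Function.update s.msgs x (e :: s.msgs x) }

theorem wp_send {x : V} {e : V × ℕ} {s : Mem V} {Q : Mem V → ℕ → Prop}
    (h : ∀ t ≤ 3, Q (Mem.deliver x e s) t) : WP (send x e) s Q := by
  apply WP.seq
  apply WP.when
  · intro hb
    apply WP.op; apply WP.op
    simpa [Mem.deliver, Mem.pushMsg, Mem.pushReceiver, hb] using h 3 (by omega)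
  · intro hb
    apply WP.op
    simpa [Mem.deliver, Mem.pushMsg, hb] using h 2 (by omega)

theorem Mailbox.deliver {s : Mem V} (h : Mailbox s.receivers s.msgs) (x : V) (e : V × ℕ) :
    Mailbox (Mem.deliver x e s).receivers (Mem.deliver x e s).msgs := by
  constructor
  · simp only [Mem.deliver]
    split_ifs with hx
    · rw [List.nodup_cons]
      refine ⟨fun hm => (h.mem x).1 hm (by simpa using hx), h.nodup⟩
    · exact h.nodup
  · intro y
    simp only [Mem.deliver]
    by_cases hy : y = x
    · subst hy
      simp only [Function.update_self, ne_eq, reduceCtorEq, not_false_eq_true, iff_true]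
      split_ifs with hx
      · simp
      · exact (h.mem y).2 (by simpa using hx)
    · rw [Function.update_of_ne hy, ← h.mem]
      split_ifs with hx
      · simp [hy]
      · rfl

theorem Mailbox.clear {x : V} {l : List V} {m : V → List (V × ℕ)} (h : Mailbox (x :: l) m) :
    Mailbox l (Function.update m x []) := by
  have hnd := List.nodup_cons.1 h.nodup
  refine ⟨hnd.2, fun y => ?_⟩
  by_cases hy : y = x
  · subst hy; simpa using hnd.1
  · rw [Function.update_of_ne hy, ← h.mem]
    simp [hy]

end Mailbox

/-! ### Effects of the simple list traversals -/

section Folds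

/-- For PLL and BVC-PLL the outcome of a distance check is irrelevant to the time bound; it suffices
that the check changes nothing but `best`. -/
theorem exists_foldl_updateBest {V : Type u} (g : V × ℕ → Mem V → ℕ∞) (l : List (V × ℕ))
    (s : Mem V) :
    ∃ b, l.foldl (fun s e => Mem.updateBest (g e) (fun _ => e.2) s) s = { s with best := b } := by
  induction l generalizing s with
  | nil => exact ⟨_, rfl⟩
  | cons e l ih => exact ih _

variable {V : Type u} [DecidableEq V]

theorem exists_foldl_setDist (g : V × ℕ → ℕ∞) (l : List (V × ℕ)) (s : Mem V) :
    ∃ f, l.foldl (fun s e => Mem.setDist e.1 (g e) s) s = { s with dist := f } := by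
  induction l generalizing s with
  | nil => exact ⟨_, rfl⟩
  | cons e l ih => exact ih _

theorem exists_foldl_setTable (x : V) (l : List (V × ℕ)) (s : Mem V) :
    ∃ f, l.foldl (fun s e => Mem.setTable x e.1 e.2 s) s = { s with table := f } := by
  induction l generalizing s with
  | nil => exact ⟨_, rfl⟩
  | cons e l ih => exact ih _

theorem foldl_clearSeen (l : List V) (s : Mem V) :
    ∃ f, l.foldl (fun s x => Mem.setSeen x false s) s = { s with seen := f } ∧
      ∀ x, f x = true ↔ s.seen x = true ∧ x ∉ l := by
  induction l generalizing s with
  | nil => exact ⟨s.seen, rfl, by simp⟩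
  | cons y l ih =>
    obtain ⟨f, hf, h⟩ := ih (Mem.setSeen y false s)
    refine ⟨f, hf, fun x => ?_⟩
    rw [h, Mem.setSeen]
    by_cases hx : x = y
    · simp [hx]
    · simp [hx]

theorem foldl_clearCand (l : List (V × V)) (s : Mem V) :
    ∃ f, l.foldl (fun s p => Mem.setCand p.1 p.2 false s) s = { s with cand := f } ∧
      ∀ x h, f x h = true ↔ s.cand x h = true ∧ (x, h) ∉ l := by
  induction l generalizing s with
  | nil => exact ⟨s.cand, rfl, by simp⟩
  | cons p l ih =>
    obtain ⟨f, hf, h⟩ := ih (Mem.setCand p.1 p.2 false s)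
    refine ⟨f, hf, fun x u => ?_⟩
    rw [h, Mem.setCand]
    by_cases hx : x = p.1
    · subst hx
      by_cases hu : u = p.2
      · subst hu; simp
      · have : (p.1, u) ≠ p := fun he => hu (congrArg Prod.snd he)
        simp [hu, this]
    · have : (x, u) ≠ p := fun he => hx (congrArg Prod.fst he)
      simp [hx, this]

theorem foldl_pushLabel (x : V) (l : List (V × ℕ)) (s : Mem V) :
    l.foldl (fun s e => Mem.pushLabel x e s) s =
      { s with label := Function.update s.label x (l.reverse ++ s.label x) } := by
  induction l generalizing s with
  | nil => simp
  | cons e l ih => rw [List.foldl_cons, ih]; simp [Mem.pushLabel]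

end Folds

/-! ### Pruned landmark labeling -/

section PLL

variable {V : Type u} [Fintype V] [DecidableEq V] {G : SimpleGraph V}

/-- The invariant of the breadth-first search of PLL from `u`; `l` lists the vertices whose search
is still to come. -/
structure BfsInv (G : SimpleGraph V) (π : VertexOrder V) (u : V) (l : List V) (s : Mem V) :
    Prop where
  labelOK : LabelOK G π s.label
  fresh : ∀ x, ∀ h ∈ hubs (s.label x), h ∉ l
  nodup : (hubs s.queue).Nodup
  queue : ∀ x ∈ hubs s.queue, s.seen x = true ∧ Reach G π u x
  popped : ∀ x, u ∈ hubs (s.label x) → s.seen x = true ∧ x ∉ hubs s.queue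
  trail : ∀ x, s.seen x = true → x ∈ s.trail

/-- The cost of treating a vertex that is popped from the queue. -/
def AdjLists.popCost (A : AdjLists G) (K : ℕ) (x : V) : ℕ := 12 + 2 * K + 6 * (A.nbrs x).length

/-- The potential of a breadth-first search from `u`. -/
noncomputable def bfsPotential (A : AdjLists G) (π : VertexOrder V) (K : ℕ) (u : V) (s : Mem V) :
    ℕ :=
  ∑ x ∈ reached G π u, cond (s.seen x) 0 (A.popCost K x + 2) +
    ((hubs s.queue).map (A.popCost K)).sum + 2 * s.trail.length

variable {π : VertexOrder V} {K : ℕ}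

/-- The popped vertex releases its `popCost`, which pays for the distance check and the scan of its
neighbours. A newly seen `y` exchanges its charge `popCost + 2` for a queue entry and a trail entry;
it is reached by `u` because `x` is and `π u < π y`. -/
theorem pll_pop (A : AdjLists G) (hK : ∀ x, (reaching G π x).card ≤ K) {u : V} {l : List V}
    {s : Mem V} (hs : BfsInv G π u l s) (hu : u ∉ l) (hq : (!s.queue.isEmpty) = true) :
    WP (Cmd.read (fun s => s.queue.head?) fun q =>
        match q with
        | none => Cmd.skip
        | some (x, d) =>
          Cmd.op Mem.dequeue ;;
          Cmd.op Mem.resetBest ;;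
          (Cmd.forEach (fun s => s.label x) fun e =>
            Cmd.op (Mem.updateBest (fun s => s.dist e.1) (fun _ => e.2))) ;;
          Cmd.when (fun s => decide ((d : ℕ∞) < s.best))
            (Cmd.op (Mem.pushLabel x (u, d)) ;;
            Cmd.forList (A.nbrs x) fun y =>
              Cmd.when (fun s => !s.seen y && decide (π u < π y))
                (Cmd.op (Mem.setSeen y true) ;;
                Cmd.op (Mem.pushTrail y) ;;
                Cmd.op (Mem.enqueue (y, d + 1))))) s
      fun s' t => BfsInv G π u l s' ∧
        t + 1 + bfsPotential A π K u s' ≤ bfsPotential A π K u s := by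
  apply WP.read
  obtain ⟨⟨x, d⟩, q, hsq⟩ : ∃ e q, s.queue = e :: q := by
    cases h : s.queue with
    | nil => simp [h] at hq
    | cons e q => exact ⟨e, q, rfl⟩
  simp only [hsq, List.head?_cons]
  have hlen := hs.labelOK.length_le hK x
  have hnd := hs.nodup
  rw [hsq, hubs_cons, List.nodup_cons] at hnd
  have hx := hs.queue x (by simp [hsq])
  have hpot : bfsPotential A π K u s = bfsPotential A π K u { s with queue := q } +
      A.popCost K x := by
    simp only [bfsPotential, hsq, hubs_cons, List.map_cons, List.sum_cons]
    omega
  apply WP.seq; apply WP.op; apply WP.seq; apply WP.op; apply WP.seq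
  apply WP.forEach_op
  obtain ⟨b, hb⟩ := exists_foldl_updateBest (fun e s => s.dist e.1) (s.label x)
    (Mem.resetBest (Mem.dequeue s))
  rw [show (Mem.resetBest (Mem.dequeue s)).label x = s.label x from rfl, hb]
  have hbase : BfsInv G π u l { s with queue := q, best := b } := by
    refine ⟨hs.labelOK, hs.fresh, hnd.2, fun y hy => ?_, fun y hy => ?_, hs.trail⟩
    · exact hs.queue y (by simp only [hsq, hubs_cons, List.mem_cons]; exact Or.inr hy)
    · have := hs.popped y hy
      refine ⟨this.1, fun h => this.2 ?_⟩
      simp only [hsq, hubs_cons, List.mem_cons]; exact Or.inr h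
  have hs₀ : ({ Mem.resetBest (Mem.dequeue s) with best := b } : Mem V) =
      { s with queue := q, best := b } := by
    simp [Mem.resetBest, Mem.dequeue, hsq]
  rw [hs₀]
  apply WP.when
  · intro _
    apply WP.seq; apply WP.op
    refine (WP.forList (fun ys s' t => BfsInv G π u l s' ∧ ys ⊆ A.nbrs x ∧
      t + bfsPotential A π K u s' + 5 * ys.length ≤
        bfsPotential A π K u { s with queue := q } + 5 * (A.nbrs x).length)
      ?_ _ _ 0 ⟨?_, List.Subset.refl _, ?_⟩).mono ?_
    · rintro y ys s' t ⟨hi, hsub, ht⟩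
      rw [List.cons_subset] at hsub
      apply WP.when
      · intro hc
        simp only [Bool.and_eq_true, Bool.not_eq_true', decide_eq_true_eq] at hc
        have hry : Reach G π u y := hx.2.tail ⟨(A.mem_nbrs x y).1 hsub.1, hc.2⟩
        apply WP.seq; apply WP.op; apply WP.seq; apply WP.op; apply WP.op
        refine ⟨⟨hi.labelOK, hi.fresh, ?_, ?_, ?_, ?_⟩, hsub.2, ?_⟩
        · simp only [Mem.enqueue, Mem.pushTrail, Mem.setSeen, hubs_append, hubs_cons, hubs_nil]
          rw [List.nodup_append]
          refine ⟨hi.nodup, by simp, ?_⟩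
          intro a ha b hb
          rw [List.mem_singleton] at hb
          rintro rfl
          have := (hi.queue a ha).1
          rw [hb, hc.1] at this
          simp at this
        · intro z hz
          simp only [Mem.enqueue, Mem.pushTrail, Mem.setSeen, hubs_append, hubs_cons, hubs_nil,
            List.mem_append, List.mem_singleton] at hz ⊢
          by_cases hzy : z = y
          · subst hzy; simpa using hry
          · rw [Function.update_of_ne hzy]
            exact hi.queue z (hz.resolve_right hzy)
        · intro z hz
          simp only [Mem.enqueue, Mem.pushTrail, Mem.setSeen, hubs_append, hubs_cons, hubs_nil,
            List.mem_append, List.mem_singleton] at hz ⊢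
          have := hi.popped z hz
          have hzy : z ≠ y := by rintro rfl; rw [hc.1] at this; simp at this
          rw [Function.update_of_ne hzy]
          exact ⟨this.1, by tauto⟩
        · intro z hz
          simp only [Mem.enqueue, Mem.pushTrail, Mem.setSeen, List.mem_cons] at hz ⊢
          by_cases hzy : z = y
          · exact Or.inl hzy
          · rw [Function.update_of_ne hzy] at hz
            exact Or.inr (hi.trail z hz)
        · have := sum_add_le_sum (S := reached G π u)
            (f := fun z => cond (Function.update s'.seen y true z) 0 (A.popCost K z + 2))
            (g := fun z => cond (s'.seen z) 0 (A.popCost K z + 2)) (a := y)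
            (c := A.popCost K y + 2) (mem_reached.2 hry) (by simp [hc.1])
            (fun b _ hb => by rw [Function.update_of_ne hb])
          simp only [bfsPotential, Mem.enqueue, Mem.pushTrail, Mem.setSeen, hubs_append, hubs_cons,
            hubs_nil, List.map_append, List.sum_append, List.map_cons, List.map_nil, List.sum_cons,
            List.sum_nil, List.length_cons] at ht ⊢
          omega
      · intro _
        refine ⟨hi, hsub.2, ?_⟩
        rw [List.length_cons] at ht
        omega
    · refine ⟨fun y => ?_, fun y => ?_, hbase.nodup, hbase.queue, fun y => ?_, hbase.trail⟩
      · simp only [Mem.pushLabel]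
        by_cases hy : y = x
        · subst hy
          rw [Function.update_self, hubs_cons, List.nodup_cons]
          refine ⟨⟨fun h => ?_, (hs.labelOK y).1⟩, ?_⟩
          -- A vertex that already has the hub `u` has left the queue, whereas this one was just at
          -- its head. So the new entry is not a repetition.
          · have := (hs.popped y h).2
            simp [hsq] at this
          · intro h hh
            rcases List.mem_cons.1 hh with rfl | hh
            · exact hx.2
            · exact (hs.labelOK y).2 h hh
        · rw [Function.update_of_ne hy]
          exact hs.labelOK y
      · simp only [Mem.pushLabel]
        by_cases hy : y = x
        · subst hy
          rw [Function.update_self, hubs_cons]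
          intro h hh
          rcases List.mem_cons.1 hh with rfl | hh
          · exact hu
          · exact hs.fresh y h hh
        · rw [Function.update_of_ne hy]
          exact hs.fresh y
      · simp only [Mem.pushLabel]
        by_cases hy : y = x
        · subst hy
          exact fun _ => ⟨hx.1, hnd.1⟩
        · rw [Function.update_of_ne hy]
          exact hbase.popped y
    · rw [zero_add]; exact le_rfl
    · rintro s' t ⟨hi, -, ht⟩
      refine ⟨hi, ?_⟩
      rw [hpot]
      simp only [AdjLists.popCost, List.length_nil] at ht ⊢
      omega
  · intro _
    refine ⟨hbase, ?_⟩
    rw [hpot]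
    have : bfsPotential A π K u { s with queue := q, best := b } =
      bfsPotential A π K u { s with queue := q } := rfl
    rw [this]
    simp only [AdjLists.popCost]
    omega

/-- The cost of the search from `u`. -/
noncomputable def AdjLists.searchCost (A : AdjLists G) (π : VertexOrder V) (K : ℕ) (u : V) : ℕ :=
  4 * K + 20 + ∑ x ∈ reached G π u, (A.popCost K x + 2)

/-- The searches are charged separately. Between them flags, trail and queue are empty, and no label
contains a vertex whose search is still to come, so `u` is a new hub everywhere when its search
starts. -/
theorem wp_pll (A : AdjLists G) (hK : ∀ x, (reaching G π x).card ≤ K) :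
    WP (pll A π) (Mem.start V) fun _ t => t ≤ ∑ u, A.searchCost π K u := by
  refine (WP.forList (fun l s t => (LabelOK G π s.label ∧
    (∀ x, ∀ h ∈ hubs (s.label x), h ∉ l) ∧ (∀ x, s.seen x = false) ∧ s.trail = [] ∧
    s.queue = [] ∧ l.Nodup) ∧ t + (l.map (A.searchCost π K)).sum ≤ ∑ u, A.searchCost π K u)
    ?_ _ _ 0 ⟨⟨?_, ?_, fun _ => rfl, rfl, rfl, π.nodup_vertices⟩, ?_⟩).mono ?_
  · rintro u l s t ⟨⟨hL, hf, hseen, htr, hq, hnd⟩, ht⟩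
    rw [List.nodup_cons] at hnd
    apply WP.seq
    apply WP.forEach_op
    obtain ⟨f, hfold⟩ := exists_foldl_setDist (fun e => (e.2 : ℕ∞)) (s.label u) s
    rw [hfold]
    apply WP.seq; apply WP.op; apply WP.seq; apply WP.op; apply WP.seq; apply WP.op
    apply WP.seq
    set N := ∑ x ∈ reached G π u, (A.popCost K x + 2)
    refine (WP.loop N (fun s' t' => BfsInv G π u l s' ∧ t' + bfsPotential A π K u s' ≤ N)
      (fun _ _ h => by omega) ?_ _ 0 ⟨⟨?_, ?_, ?_, ?_, ?_, ?_⟩, ?_⟩).mono ?_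
    · rintro s' t' ⟨hi, ht'⟩ hb
      refine (pll_pop A hK hi hnd.1 hb).mono ?_
      rintro s₂ t₂ ⟨hi₂, ht₂⟩
      exact ⟨hi₂, by omega⟩
    · exact hL
    · exact fun x h hh hl => hf x h hh (List.mem_cons_of_mem _ hl)
    · simp [Mem.enqueue, Mem.pushTrail, Mem.setSeen, hq]
    · intro x hx
      simp only [Mem.enqueue, Mem.pushTrail, Mem.setSeen, hq, List.nil_append, hubs_cons, hubs_nil,
        List.mem_singleton] at hx ⊢
      subst hx
      exact ⟨by simp, .refl⟩
    · intro x hx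
      exact absurd List.mem_cons_self (hf x u hx)
    · intro x hx
      simp only [Mem.enqueue, Mem.pushTrail, Mem.setSeen] at hx ⊢
      by_cases hxu : x = u
      · simp [hxu]
      · rw [Function.update_of_ne hxu, hseen] at hx
        simp at hx
    · have := sum_add_le_sum (S := reached G π u)
        (f := fun z => cond (Function.update s.seen u true z) 0 (A.popCost K z + 2))
        (g := fun z => A.popCost K z + 2) (a := u)
        (c := A.popCost K u + 2) (mem_reached.2 .refl) (by simp)
        (fun b _ hb => by rw [Function.update_of_ne hb]; cases s.seen b <;> simp)
      simp only [bfsPotential, Mem.enqueue, Mem.pushTrail, Mem.setSeen, hq, htr, List.nil_append,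
        hubs_cons, hubs_nil, List.map_cons, List.map_nil, List.sum_cons, List.sum_nil,
        List.length_cons, List.length_nil]
      omega
    · rintro s₁ t₁ ⟨hb, t₀, rfl, hi, ht₀⟩
      have hq₁ : s₁.queue = [] := by simpa using hb
      apply WP.seq
      apply WP.forEach_op
      obtain ⟨f', hfold', hf'⟩ := foldl_clearSeen s₁.trail s₁
      rw [hfold']
      apply WP.seq; apply WP.op
      apply WP.forEach_op
      obtain ⟨f₂, hfold₂⟩ := exists_foldl_setDist (fun _ => ⊤) (s₁.label u)
        (Mem.clearTrail { s₁ with seen := f' })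
      rw [show (Mem.clearTrail { s₁ with seen := f' }).label u = s₁.label u from rfl, hfold₂]
      refine ⟨⟨hi.labelOK, hi.fresh, fun x => ?_, rfl, hq₁, hnd.2⟩, ?_⟩
      · by_contra hx
        have hx' := (hf' x).1 (by simpa [Mem.clearTrail] using hx)
        exact hx'.2 (hi.trail x hx'.1)
      -- The summand `4 * K` of `searchCost` pays for traversing the label of `u` before and after
      -- the search; the trail term left in the potential pays for clearing the flags.
      · have h₁ := hL.length_le hK u
        have h₂ := hi.labelOK.length_le hK u
        have h₃ : 2 * s₁.trail.length ≤ bfsPotential A π K u s₁ := Nat.le_add_left _ _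
        rw [List.map_cons, List.sum_cons] at ht
        have h₄ : A.searchCost π K u = 4 * K + 20 + N := rfl
        omega
  · intro x
    simp [Mem.start]
  · intro x
    simp [Mem.start]
  · rw [zero_add, π.sum_vertices]
  · rintro s t ⟨-, ht⟩
    omega

omit [DecidableEq V] in
theorem sum_searchCost_le (A : AdjLists G) (hK : ∀ x, (reaching G π x).card ≤ K) :
    ∑ u, A.searchCost π K u ≤ 40 * (Fintype.card V * K ^ 2 + A.size * K) := by
  simp only [AdjLists.searchCost]
  rw [Finset.sum_add_distrib]
  have h₁ := sum_reached_le hK fun x => A.popCost K x + 2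
  have h₂ : ∑ x, (A.popCost K x + 2) = Fintype.card V * (14 + 2 * K) + 6 * A.size := by
    simp only [AdjLists.popCost, AdjLists.size, Finset.sum_add_distrib, Finset.sum_const,
      Finset.card_univ, smul_eq_mul, Finset.mul_sum]
    ring
  rw [h₂] at h₁
  rw [Finset.sum_const, Finset.card_univ, smul_eq_mul]
  refine (Nat.add_le_add_left h₁ _).trans ?_
  -- Absorbing the lower-order terms needs `1 ≤ K`, hence a vertex; without vertices everything
  -- vanishes.
  rcases isEmpty_or_nonempty V with hV | ⟨⟨x⟩⟩
  · simp [AdjLists.size]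
  · have h₃ := one_le_of_card_reaching hK x
    nlinarith [Nat.zero_le (A.size * K), Nat.mul_le_mul_left (Fintype.card V) h₃,
      Nat.mul_le_mul_left (Fintype.card V * K) h₃]

end PLL

/-! ### Batched vertex-centric pruned landmark labeling -/

section BVC

variable {V : Type u} [Fintype V] [DecidableEq V] {G : SimpleGraph V}

/-- The rank of `u` belongs to the batch number `i`. -/
def InBatch (π : VertexOrder V) (b i : ℕ) (u : V) : Prop := i * b ≤ π u ∧ (π u : ℕ) < (i + 1) * b

/-- The invariant of the rounds of BVC-PLL within the batch number `i`. -/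
structure BvcInv (G : SimpleGraph V) (π : VertexOrder V) (b i : ℕ) (s : Mem V) : Prop where
  batchNo : s.batchNo = i
  labelOK : LabelOK G π s.label
  hub_lt : ∀ x, ∀ h ∈ hubs (s.label x), (π h : ℕ) < (i + 1) * b
  cand_of_hub : ∀ x, ∀ h ∈ hubs (s.label x), i * b ≤ π h → s.cand x h = true ∨ h = x
  cand : ∀ x h, s.cand x h = true → Reach G π h x ∧ InBatch π b i h ∧ (x, h) ∈ s.candTrail
  newLabel : ∀ a ∈ s.active, s.newLabel a ≠ [] ∧
    ∀ h ∈ hubs (s.newLabel a), Reach G π h a ∧ InBatch π b i h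

/-- The messages of BVC-PLL are recorded in the candidate bit-vectors. -/
def MsgsOK (s : Mem V) : Prop := ∀ x, (hubs (s.msgs x)).Nodup ∧
  ∀ h ∈ hubs (s.msgs x), s.cand x h = true ∧ h ∉ hubs (s.label x)

/-- The charge for a new label entry of an active vertex. -/
def AdjLists.scatterCost (A : AdjLists G) (a : V) : ℕ := 40 * (A.nbrs a).length + 10

/-- The charge for a message. -/
def AdjLists.msgCost (A : AdjLists G) (K : ℕ) (x : V) : ℕ := 2 * K + 30 + A.scatterCost x

/-- The charge for the active vertices. -/
def AdjLists.activeCost (A : AdjLists G) (s : Mem V) : ℕ :=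
  (s.active.map fun a => (s.newLabel a).length * A.scatterCost a).sum

/-- The potential of the candidate bits that are still to be set, of the messages, and of the bits
that have to be cleared. -/
noncomputable def candPotential (A : AdjLists G) (π : VertexOrder V) (K m : ℕ) (s : Mem V) : ℕ :=
  ∑ p ∈ reachPairs G π,
      (if m ≤ π p.1 then cond (s.cand p.2 p.1) 0 (A.msgCost K p.2 + 2) else 0) +
    ∑ x, (s.msgs x).length * A.msgCost K x + 2 * s.candTrail.length

variable {π : VertexOrder V} {K b i : ℕ}

/-- Sending sets a candidate bit that was clear and stays set for the rest of the batch, so a pair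
pays for at most one message. Its charge `msgCost + 2` is split between the message and the later
clearing of the bit. -/
theorem bvc_message (A : AdjLists G) {a x : V} (hax : x ∈ A.nbrs a) {e : V × ℕ} {s : Mem V}
    (hs : BvcInv G π b i s) (hm : MsgsOK s) (hbox : Mailbox s.receivers s.msgs)
    (hr : Reach G π e.1 a) (he : InBatch π b i e.1) :
    WP (Cmd.when (fun s => decide (π e.1 < π x) && !s.cand x e.1)
          (Cmd.op (Mem.setCand x e.1 true) ;;
          Cmd.op (Mem.pushCandTrail (x, e.1)) ;;
          send x (e.1, e.2 + 1))) s
      fun s' t => t ≤ 6 ∧ BvcInv G π b i s' ∧ MsgsOK s' ∧ Mailbox s'.receivers s'.msgs ∧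
        s'.active = s.active ∧ s'.newLabel = s.newLabel ∧
        candPotential A π K (i * b) s' ≤ candPotential A π K (i * b) s := by
  apply WP.when
  · intro hc
    simp only [Bool.and_eq_true, Bool.not_eq_true', decide_eq_true_eq] at hc
    have hrx : Reach G π e.1 x := hr.tail ⟨(A.mem_nbrs a x).1 hax, hc.1⟩
    apply WP.seq; apply WP.op; apply WP.seq; apply WP.op; apply wp_send
    intro t ht
    have hcand : ∀ y h, Function.update s.cand x (Function.update (s.cand x) e.1 true) y h = true ↔
        s.cand y h = true ∨ (y = x ∧ h = e.1) := by
      intro y h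
      by_cases hy : y = x
      · subst hy
        by_cases hh : h = e.1
        · subst hh; simp
        · simp [hh]
      · simp [hy]
    refine ⟨by omega, ⟨hs.batchNo, hs.labelOK, hs.hub_lt, ?_, ?_, hs.newLabel⟩, ?_,
      Mailbox.deliver hbox _ _, rfl, rfl, ?_⟩
    · intro y h hh hih
      have := hs.cand_of_hub y h hh hih
      simp only [Mem.deliver, Mem.pushCandTrail, Mem.setCand, hcand]
      tauto
    · intro y h hyh
      simp only [Mem.deliver, Mem.pushCandTrail, Mem.setCand, hcand, List.mem_cons,
        Prod.mk.injEq] at hyh ⊢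
      rcases hyh with hyh | ⟨rfl, rfl⟩
      · have := hs.cand y h hyh
        tauto
      · exact ⟨hrx, he, by simp⟩
    · intro y
      simp only [Mem.deliver, Mem.pushCandTrail, Mem.setCand, hcand]
      by_cases hy : y = x
      · subst hy
        rw [Function.update_self, hubs_cons, List.nodup_cons]
        refine ⟨⟨fun h => ?_, (hm y).1⟩, fun h hh => ?_⟩
        · have := ((hm y).2 _ h).1
          rw [hc.2] at this
          simp at this
        · rcases List.mem_cons.1 hh with rfl | hh
          · refine ⟨by simp, fun h => ?_⟩
            rcases hs.cand_of_hub y _ h he.1 with h' | h'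
            · rw [hc.2] at h'
              simp at h'
            -- The alternative `h = x` in `cand_of_hub` accounts for the entries `(x, 0)`, which
            -- never were messages; the rank test excludes it.
            · have := hc.1
              rw [h'] at this
              exact lt_irrefl _ this
          · have := (hm y).2 h hh
            tauto
      · rw [Function.update_of_ne hy]
        refine ⟨(hm y).1, fun h hh => ?_⟩
        have := (hm y).2 h hh
        tauto
    · have h₁ := sum_add_le_sum (S := reachPairs G π)
        (f := fun p => if i * b ≤ π p.1 then
          cond (Function.update s.cand x (Function.update (s.cand x) e.1 true) p.2 p.1) 0
            (A.msgCost K p.2 + 2) else 0)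
        (g := fun p => if i * b ≤ π p.1 then cond (s.cand p.2 p.1) 0 (A.msgCost K p.2 + 2) else 0)
        (a := (e.1, x)) (c := A.msgCost K x + 2) (mem_reachPairs.2 hrx)
        (by simp [hc.2, he.1])
        (fun p _ hp => by
          have : Function.update s.cand x (Function.update (s.cand x) e.1 true) p.2 p.1 =
              s.cand p.2 p.1 := by
            by_cases h₁ : p.2 = x
            · have h₂ : p.1 ≠ e.1 := fun h₂ => hp (Prod.ext h₂ h₁)
              rw [h₁, Function.update_self, Function.update_of_ne h₂]
            · rw [Function.update_of_ne h₁]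
          rw [this])
      have h₂ := sum_le_sum_add (S := Finset.univ)
        (f := fun y => (Function.update s.msgs x ((e.1, e.2 + 1) :: s.msgs x) y).length *
          A.msgCost K y)
        (g := fun y => (s.msgs y).length * A.msgCost K y) (a := x) (c := A.msgCost K x)
        (Finset.mem_univ _) (by simp [add_mul])
        (fun y _ hy => by rw [Function.update_of_ne hy])
      simp only [candPotential, Mem.deliver, Mem.pushCandTrail, Mem.setCand, List.length_cons]
      omega
  · intro _
    exact ⟨by omega, hs, hm, hbox, rfl, rfl, le_rfl⟩

/-- An active vertex has at least one new entry, and each of them carries `scatterCost`, enough for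
its share of the neighbour scan. The surplus of 9 per active vertex pays for the constant costs of
the round. -/
theorem wp_bvcScatter (A : AdjLists G) {s : Mem V} (hs : BvcInv G π b i s)
    (hmsgs : ∀ x, s.msgs x = []) (hrec : s.receivers = []) :
    WP (bvcScatter A π) s fun s' t => BvcInv G π b i s' ∧ MsgsOK s' ∧
      Mailbox s'.receivers s'.msgs ∧
      candPotential A π K (i * b) s' ≤ candPotential A π K (i * b) s ∧
      t + 9 * s.active.length ≤ A.activeCost s + 1 := by
  let J : Mem V → Prop := fun s' => BvcInv G π b i s' ∧ MsgsOK s' ∧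
    Mailbox s'.receivers s'.msgs ∧ s'.active = s.active ∧ s'.newLabel = s.newLabel ∧
    candPotential A π K (i * b) s' ≤ candPotential A π K (i * b) s
  apply WP.read
  refine (WP.forList (fun l s' t => J s' ∧ l ⊆ s.active ∧ t + 9 * s.active.length +
    (l.map fun a => (s.newLabel a).length * A.scatterCost a).sum ≤
      A.activeCost s + 9 * l.length) ?_ s.active s 0 ⟨⟨hs, ?_, ?_, rfl, rfl, le_rfl⟩,
      List.Subset.refl _, ?_⟩).mono ?_
  · rintro a l s₁ t ⟨hJ, hl, ht⟩
    rw [List.cons_subset] at hl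
    have hne := List.length_pos_iff.2 (hs.newLabel a hl.1).1
    refine (WP.forList (fun xs s' t => J s' ∧ xs ⊆ A.nbrs a ∧
      t + xs.length * (7 * (s.newLabel a).length + 2) ≤
        (A.nbrs a).length * (7 * (s.newLabel a).length + 2)) ?_ (A.nbrs a) s₁ 0
        ⟨hJ, List.Subset.refl _, by rw [zero_add]⟩).mono ?_
    · rintro x xs s₂ t₂ ⟨hJ₂, hxs, ht₂⟩
      rw [List.cons_subset] at hxs
      apply WP.read
      rw [hJ₂.2.2.2.2.1]
      refine (WP.forList (fun es s' t => J s' ∧ es ⊆ s.newLabel a ∧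
        t + 7 * es.length ≤ 7 * (s.newLabel a).length) ?_ _ _ 0
          ⟨hJ₂, List.Subset.refl _, by omega⟩).mono ?_
      · rintro e es s₃ t₃ ⟨hJ₃, hes, ht₃⟩
        rw [List.cons_subset] at hes
        have hnew := (hs.newLabel a hl.1).2 e.1 (mem_hubs_of_mem hes.1)
        refine (bvc_message (K := K) A hxs.1 hJ₃.1 hJ₃.2.1 hJ₃.2.2.1 hnew.1 hnew.2).mono ?_
        rintro s₄ t₄ ⟨ht₄, h₁, h₂, h₃, h₄, h₅, h₆⟩
        refine ⟨⟨h₁, h₂, h₃, h₄.trans hJ₃.2.2.2.1, h₅.trans hJ₃.2.2.2.2.1,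
          h₆.trans hJ₃.2.2.2.2.2⟩, hes.2, ?_⟩
        rw [List.length_cons] at ht₃
        omega
      · rintro s₃ t₃ ⟨hJ₃, -, ht₃⟩
        refine ⟨hJ₃, hxs.2, ?_⟩
        rw [List.length_cons, add_mul] at ht₂
        omega
    · rintro s₂ t₂ ⟨hJ₂, -, ht₂⟩
      refine ⟨hJ₂, hl.2, ?_⟩
      simp only [List.map_cons, List.sum_cons, List.length_cons] at ht
      have : t₂ + 1 + 9 ≤ (s.newLabel a).length * A.scatterCost a := by
        simp only [AdjLists.scatterCost, List.length_nil] at ht₂ ⊢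
        nlinarith [Nat.mul_le_mul_left (A.nbrs a).length hne]
      omega
  · intro x
    simp [hmsgs x]
  · rw [hrec]
    exact Mailbox.empty hmsgs
  · rw [zero_add, AdjLists.activeCost, add_comm]
  · rintro s' t ⟨⟨h₁, h₂, h₃, -, -, h₄⟩, -, ht⟩
    simp only [List.map_nil, List.sum_nil, List.length_nil] at ht
    exact ⟨h₁, h₂, h₃, h₄, by omega⟩

/-- The memory after the treatment of a receiver `x` that accepts the messages `l`. -/
def Mem.accept (x : V) (l : List (V × ℕ)) (best : ℕ∞) (table : V → V → ℕ∞) (s : Mem V) : Mem V :=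
  { s with
    newLabel := Function.update s.newLabel x l
    best := best
    msgs := Function.update s.msgs x []
    label := Function.update s.label x (l.reverse ++ s.label x)
    active := if l.isEmpty then s.active else x :: s.active
    table := table }

/-- Whatever the distance checks answer, the accepted entries are, up to reversal, a sublist of the
messages. The label of `x` grows only after all its messages are checked, so each check traverses at
most `K` entries. -/
theorem bvc_receiver (hK : ∀ x, (reaching G π x).card ≤ K) {x : V} {s : Mem V}
    (hL : LabelOK G π s.label) :
    WP (Cmd.op (Mem.setNewLabel x []) ;;
      (Cmd.forEach (fun s => s.msgs x) fun e =>
        Cmd.op Mem.resetBest ;;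
        (Cmd.forEach (fun s => s.label x) fun f =>
          Cmd.op (Mem.updateBest (fun s => s.table e.1 f.1) (fun _ => f.2))) ;;
        Cmd.when (fun s => decide ((e.2 : ℕ∞) < s.best)) (Cmd.op (Mem.pushNewLabel x e))) ;;
      Cmd.op (Mem.clearMsgs x) ;;
      Cmd.when (fun s => !(s.newLabel x).isEmpty)
        ((Cmd.forEach (fun s => s.newLabel x) fun e => Cmd.op (Mem.pushLabel x e)) ;;
        Cmd.op (Mem.pushActive x)) ;;
      Cmd.when (fun s => decide ((π x : ℕ) / b = s.batchNo))
        (Cmd.forEach (fun s => s.newLabel x) fun e => Cmd.op (Mem.setTable x e.1 e.2))) s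
      fun s' t => ∃ l best table, l.reverse.Sublist (s.msgs x) ∧ s' = Mem.accept x l best table s ∧
        t ≤ (2 * K + 10) * (s.msgs x).length + 10 := by
  apply WP.seq; apply WP.op; apply WP.seq; apply WP.read
  refine (WP.forList (fun ms s' t => ∃ l best, (l.reverse ++ ms).Sublist (s.msgs x) ∧
    s' = { s with newLabel := Function.update s.newLabel x l, best := best } ∧
    t + (2 * K + 5) * ms.length ≤ (2 * K + 5) * (s.msgs x).length) ?_ (s.msgs x) _ 0
    ⟨[], s.best, by simp, rfl, by omega⟩).mono ?_
  · rintro e ms _ t ⟨l, best, hl, rfl, ht⟩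
    apply WP.seq; apply WP.op; apply WP.seq; apply WP.forEach_op
    obtain ⟨best', hb⟩ := exists_foldl_updateBest (fun f s => s.table e.1 f.1) (s.label x)
      (Mem.resetBest { s with newLabel := Function.update s.newLabel x l, best := best })
    simp only [Mem.resetBest] at hb ⊢
    rw [hb]
    have hlen := hL.length_le hK x
    rw [List.length_cons, mul_add] at ht
    apply WP.when
    · intro _
      apply WP.op
      refine ⟨e :: l, best', by simpa using hl, ?_, by omega⟩
      simp [Mem.pushNewLabel]
    · intro _
      refine ⟨l, best', ?_, rfl, by omega⟩
      refine List.Sublist.trans ?_ hl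
      exact (List.sublist_cons_self e ms).append_left _
  · rintro _ t ⟨l, best, hl, rfl, ht⟩
    rw [List.append_nil] at hl
    have hlen := hl.length_le
    rw [List.length_reverse] at hlen
    apply WP.seq; apply WP.op; apply WP.seq
    have hmid : WP (Cmd.when (fun s => !(s.newLabel x).isEmpty)
        ((Cmd.forEach (fun s => s.newLabel x) fun e => Cmd.op (Mem.pushLabel x e)) ;;
        Cmd.op (Mem.pushActive x)))
        (Mem.clearMsgs x { s with newLabel := Function.update s.newLabel x l, best := best })
        fun s' t => s' = Mem.accept x l best s.table s ∧ t ≤ 2 * l.length + 3 := by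
      apply WP.when
      · intro hne
        simp only [Mem.clearMsgs, Function.update_self, Bool.not_eq_true'] at hne
        apply WP.seq; apply WP.forEach_op; apply WP.op
        rw [foldl_pushLabel]
        simp only [Mem.clearMsgs, Function.update_self, Mem.pushActive, Mem.accept, hne]
        exact ⟨rfl, by omega⟩
      · intro he
        simp only [Mem.clearMsgs, Function.update_self, Bool.not_eq_false', List.isEmpty_iff] at he
        subst he
        simp [Mem.clearMsgs, Mem.accept]
    refine hmid.mono ?_
    rintro _ t₂ ⟨rfl, ht₂⟩
    have h₁ : (2 * K + 10) * (s.msgs x).length =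
      (2 * K + 5) * (s.msgs x).length + 5 * (s.msgs x).length := by ring
    rw [List.length_nil] at ht
    apply WP.when
    · intro _
      apply WP.forEach_op
      have hnl : (Mem.accept x l best s.table s).newLabel x = l := by simp [Mem.accept]
      obtain ⟨tb, htb⟩ := exists_foldl_setTable x l (Mem.accept x l best s.table s)
      rw [hnl, htb]
      exact ⟨l, best, tb, hl, rfl, by omega⟩
    · intro _
      exact ⟨l, best, s.table, hl, rfl, by omega⟩

/-- The charge `msgCost` of a message pays for its distance check and, if the message is accepted,
hands `scatterCost x` on to the next scatter phase. -/
theorem wp_bvcGather (A : AdjLists G) (hK : ∀ x, (reaching G π x).card ≤ K) {s : Mem V}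
    (hs : BvcInv G π b i s) (hm : MsgsOK s) (hbox : Mailbox s.receivers s.msgs)
    (hact : s.active = []) :
    WP (bvcGather π b) s fun s' t => BvcInv G π b i s' ∧ (∀ x, s'.msgs x = []) ∧
      s'.receivers = [] ∧ t + candPotential A π K (i * b) s' + A.activeCost s' ≤
        candPotential A π K (i * b) s + 2 := by
  apply WP.seq; apply WP.read
  refine (WP.forList (fun l s' t => BvcInv G π b i s' ∧ MsgsOK s' ∧ Mailbox l s'.msgs ∧
    (∀ a ∈ s'.active, s'.msgs a = []) ∧
    t + candPotential A π K (i * b) s' + A.activeCost s' ≤ candPotential A π K (i * b) s)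
    ?_ _ _ 0 ⟨hs, hm, hbox, by simp [hact], ?_⟩).mono ?_
  · rintro x l s₁ t ⟨hs₁, hm₁, hbox₁, hact₁, ht⟩
    refine (bvc_receiver (b := b) hK hs₁.labelOK).mono ?_
    rintro _ t' ⟨nl, best, tb, hsub, rfl, ht'⟩
    have hne : s₁.msgs x ≠ [] := (hbox₁.mem x).1 List.mem_cons_self
    have hpos := List.length_pos_iff.2 hne
    -- Since `x` still has messages, it is not active yet, and replacing its new labels does not
    -- affect the charge for the active vertices.
    have hxact : x ∉ s₁.active := fun h => hne (hact₁ x h)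
    have hsub' : (hubs nl).reverse.Sublist (hubs (s₁.msgs x)) := by
      rw [← hubs_reverse]
      exact hsub.map _
    have hnl : ∀ h ∈ hubs nl, h ∈ hubs (s₁.msgs x) := fun h hh =>
      hsub'.subset (List.mem_reverse.2 hh)
    have hlab : ∀ h, h ∈ hubs (nl.reverse ++ s₁.label x) ↔ h ∈ hubs nl ∨ h ∈ hubs (s₁.label x) := by
      intro h; simp
    have hmsg : ∀ h ∈ hubs nl, s₁.cand x h = true ∧ h ∉ hubs (s₁.label x) ∧ Reach G π h x ∧
        InBatch π b i h := fun h hh =>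
      have h₁ := (hm₁ x).2 h (hnl h hh)
      have h₂ := hs₁.cand x h h₁.1
      ⟨h₁.1, h₁.2, h₂.1, h₂.2.1⟩
    refine ⟨⟨hs₁.batchNo, ?_, ?_, ?_, hs₁.cand, ?_⟩, ?_, hbox₁.clear, ?_, ?_⟩
    · intro y
      simp only [Mem.accept]
      by_cases hy : y = x
      · subst hy
        rw [Function.update_self]
        constructor
        · rw [hubs_append, hubs_reverse, List.nodup_append]
          refine ⟨hsub'.nodup (hm₁ y).1, (hs₁.labelOK y).1, ?_⟩
          rintro a ha c hc rfl
          exact (hmsg a (List.mem_reverse.1 ha)).2.1 hc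
        · intro h hh
          rcases (hlab h).1 hh with hh | hh
          · exact (hmsg h hh).2.2.1
          · exact (hs₁.labelOK y).2 h hh
      · rw [Function.update_of_ne hy]
        exact hs₁.labelOK y
    · intro y
      simp only [Mem.accept]
      by_cases hy : y = x
      · subst hy
        rw [Function.update_self]
        intro h hh
        rcases (hlab h).1 hh with hh | hh
        · exact (hmsg h hh).2.2.2.2
        · exact hs₁.hub_lt y h hh
      · rw [Function.update_of_ne hy]
        exact hs₁.hub_lt y
    · intro y
      simp only [Mem.accept]
      by_cases hy : y = x
      · subst hy
        rw [Function.update_self]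
        intro h hh
        rcases (hlab h).1 hh with hh | hh
        · exact fun _ => Or.inl (hmsg h hh).1
        · exact hs₁.cand_of_hub y h hh
      · rw [Function.update_of_ne hy]
        exact hs₁.cand_of_hub y
    · intro a ha
      simp only [Mem.accept] at ha ⊢
      by_cases hy : a = x
      · subst hy
        rw [Function.update_self]
        refine ⟨?_, fun h hh => (hmsg h hh).2.2⟩
        rintro rfl
        exact hxact (by simpa using ha)
      · rw [Function.update_of_ne hy]
        refine hs₁.newLabel a ?_
        split_ifs at ha
        · exact ha
        · exact (List.mem_cons.1 ha).resolve_left hy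
    · intro y
      simp only [Mem.accept]
      by_cases hy : y = x
      · subst hy; simp
      · rw [Function.update_of_ne hy, Function.update_of_ne hy]
        exact hm₁ y
    · intro a ha
      simp only [Mem.accept] at ha ⊢
      by_cases hy : a = x
      · subst hy; simp
      · rw [Function.update_of_ne hy]
        refine hact₁ a ?_
        split_ifs at ha
        · exact ha
        · exact (List.mem_cons.1 ha).resolve_left hy
    · have h₁ := sum_add_le_sum (S := Finset.univ)
        (f := fun y => (Function.update s₁.msgs x [] y).length * A.msgCost K y)
        (g := fun y => (s₁.msgs y).length * A.msgCost K y) (a := x)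
        (c := (s₁.msgs x).length * A.msgCost K x)
        (Finset.mem_univ _) (by simp)
        (fun y _ hy => by rw [Function.update_of_ne hy])
      have h₂ : A.activeCost (Mem.accept x nl best tb s₁) ≤
          A.activeCost s₁ + (s₁.msgs x).length * A.scatterCost x := by
        have hmap : s₁.active.map (fun a => (Function.update s₁.newLabel x nl a).length *
            A.scatterCost a) = s₁.active.map fun a => (s₁.newLabel a).length * A.scatterCost a := by
          refine List.map_congr_left fun a ha => ?_
          have : a ≠ x := by rintro rfl; exact hxact ha
          rw [Function.update_of_ne this]
        have hlen := hsub.length_le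
        rw [List.length_reverse] at hlen
        simp only [AdjLists.activeCost, Mem.accept]
        split_ifs
        · rw [hmap]; omega
        · rw [List.map_cons, List.sum_cons, hmap, Function.update_self]
          have := Nat.mul_le_mul_right (A.scatterCost x) hlen
          omega
      have h₃ : (s₁.msgs x).length * A.msgCost K x =
          (2 * K + 10) * (s₁.msgs x).length + 20 * (s₁.msgs x).length +
            (s₁.msgs x).length * A.scatterCost x := by
        rw [AdjLists.msgCost]; ring
      have h₄ : candPotential A π K (i * b) (Mem.accept x nl best tb s₁) +
          (s₁.msgs x).length * A.msgCost K x ≤ candPotential A π K (i * b) s₁ := by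
        simp only [candPotential, Mem.accept]
        omega
      omega
  · simp [AdjLists.activeCost, hact]
  · rintro s' t ⟨hs', -, hbox', -, ht⟩
    apply WP.op
    refine ⟨⟨hs'.batchNo, hs'.labelOK, hs'.hub_lt, hs'.cand_of_hub, hs'.cand, hs'.newLabel⟩,
      hbox'.eq_nil, rfl, ?_⟩
    simp only [candPotential, AdjLists.activeCost, Mem.clearReceivers] at ht ⊢
    omega

end BVC

/-! ### Roots, rounds and the total charge over all batches -/

section BVC

variable {V : Type u} [Fintype V] [DecidableEq V] {G : SimpleGraph V} {π : VertexOrder V}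
  {K b i : ℕ}

omit [DecidableEq V] in
theorem inBatch_of_mem_batch {u : V} (h : u ∈ batch π b i) : InBatch π b i u := by
  obtain ⟨j, hj, rfl⟩ := List.mem_iff_getElem.1 h
  rw [batch, List.length_take] at hj
  simp only [batch, VertexOrder.vertices, List.getElem_take, List.getElem_drop, List.getElem_map,
    InBatch, Equiv.apply_symm_apply, List.getElem_finRange, Fin.val_cast, add_mul]
  omega

omit [DecidableEq V] in
theorem nodup_batch : (batch π b i).Nodup :=
  π.nodup_vertices.sublist ((List.take_sublist _ _).trans (List.drop_sublist _ _))

/-- The charge for the entry `(u, 0)`. -/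
def AdjLists.rootCost (A : AdjLists G) (K : ℕ) (u : V) : ℕ := 2 * K + 10 + A.scatterCost u

/-- The invariant of BVC-PLL between two batches. -/
structure BatchInv (G : SimpleGraph V) (π : VertexOrder V) (b i : ℕ) (s : Mem V) : Prop where
  batchNo : s.batchNo = i
  labelOK : LabelOK G π s.label
  hub_lt : ∀ x, ∀ h ∈ hubs (s.label x), (π h : ℕ) < i * b
  cand : ∀ x h, s.cand x h = false
  active : s.active = []
  msgs : ∀ x, s.msgs x = []
  receivers : s.receivers = []
  candTrail : s.candTrail = []

/-- The entries `(u, 0)` are added for all `u` in a batch. -/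
theorem bvc_roots (A : AdjLists G) (hK : ∀ x, (reaching G π x).card ≤ K) {s : Mem V}
    (hs : BatchInv G π b i s) :
    WP (Cmd.forEach (fun s => batch π b s.batchNo) fun u =>
      Cmd.op (Mem.setNewLabel u [(u, 0)]) ;;
      Cmd.op (Mem.pushLabel u (u, 0)) ;;
      (Cmd.forEach (fun s => s.label u) fun e => Cmd.op (Mem.setTable u e.1 e.2)) ;;
      Cmd.op (Mem.pushActive u)) s
      fun s' t => BvcInv G π b i s' ∧ (∀ x, s'.msgs x = []) ∧ s'.receivers = [] ∧
        s'.candTrail = [] ∧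
        t + A.activeCost s' ≤ ((batch π b i).map (A.rootCost K)).sum + 1 := by
  apply WP.read
  rw [hs.batchNo]
  refine (WP.forList (fun l s' t => (s'.batchNo = i ∧ LabelOK G π s'.label ∧
    (∀ x, ∀ h ∈ hubs (s'.label x), (π h : ℕ) < i * b ∨ (h = x ∧ InBatch π b i h ∧ h ∉ l)) ∧
    (∀ x h, s'.cand x h = false) ∧ (∀ x, s'.msgs x = []) ∧ s'.receivers = [] ∧
    s'.candTrail = []) ∧
    (∀ a ∈ s'.active, s'.newLabel a = [(a, 0)] ∧ InBatch π b i a ∧ a ∉ l) ∧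
    l.Nodup ∧ l ⊆ batch π b i ∧
    t + (l.map (A.rootCost K)).sum + A.activeCost s' ≤ ((batch π b i).map (A.rootCost K)).sum)
    ?_ _ _ 0 ⟨⟨hs.batchNo, hs.labelOK, fun x h hh => Or.inl (hs.hub_lt x h hh), hs.cand, hs.msgs,
      hs.receivers, hs.candTrail⟩, by simp [hs.active], nodup_batch, List.Subset.refl _,
      ?_⟩).mono ?_
  · rintro u l s₁ t ⟨⟨h₁, h₂, h₃, h₄, h₅, h₆, h₇⟩, hact, hnd, hl, ht⟩
    rw [List.nodup_cons] at hnd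
    rw [List.cons_subset] at hl
    have hu := inBatch_of_mem_batch hl.1
    have hua : u ∉ s₁.active := fun h => (hact u h).2.2 List.mem_cons_self
    -- So far the hubs come from earlier batches, except for the roots of this batch that have
    -- already been treated.
    have hul : u ∉ hubs (s₁.label u) := by
      intro h
      rcases h₃ u u h with h' | h'
      · exact absurd hu.1 (by omega)
      · exact h'.2.2 List.mem_cons_self
    have hL : LabelOK G π (Function.update s₁.label u ((u, 0) :: s₁.label u)) := by
      intro y
      by_cases hy : y = u
      · subst hy
        rw [Function.update_self, hubs_cons, List.nodup_cons]
        refine ⟨⟨hul, (h₂ y).1⟩, fun h hh => ?_⟩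
        rcases List.mem_cons.1 hh with rfl | hh
        · exact .refl
        · exact (h₂ y).2 h hh
      · rw [Function.update_of_ne hy]
        exact h₂ y
    apply WP.seq; apply WP.op; apply WP.seq; apply WP.op; apply WP.seq; apply WP.forEach_op
    apply WP.op
    obtain ⟨tb, htb⟩ := exists_foldl_setTable u
      ((Mem.pushLabel u (u, 0) (Mem.setNewLabel u [(u, 0)] s₁)).label u)
      (Mem.pushLabel u (u, 0) (Mem.setNewLabel u [(u, 0)] s₁))
    rw [htb]
    have hlen := hL.length_le hK u
    refine ⟨⟨h₁, hL, fun y h hh => ?_, h₄, h₅, h₆, h₇⟩, fun a ha => ?_, hnd.2, hl.2, ?_⟩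
    · simp only [Mem.pushActive, Mem.pushLabel, Mem.setNewLabel] at hh
      have hold : h ∈ hubs (s₁.label y) → (π h : ℕ) < i * b ∨ (h = y ∧ InBatch π b i h ∧ h ∉ l) :=
        fun hh => (h₃ y h hh).imp_right fun h' =>
          ⟨h'.1, h'.2.1, fun hl => h'.2.2 (List.mem_cons_of_mem _ hl)⟩
      by_cases hy : y = u
      · subst hy
        rw [Function.update_self, hubs_cons] at hh
        rcases List.mem_cons.1 hh with rfl | hh
        · exact Or.inr ⟨rfl, hu, hnd.1⟩
        · exact hold hh
      · rw [Function.update_of_ne hy] at hh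
        exact hold hh
    · simp only [Mem.pushActive, Mem.pushLabel, Mem.setNewLabel, List.mem_cons] at ha ⊢
      by_cases hau : a = u
      · subst hau
        exact ⟨by simp, hu, hnd.1⟩
      · have := hact a (ha.resolve_left hau)
        rw [Function.update_of_ne hau]
        exact ⟨this.1, this.2.1, fun hl => this.2.2 (List.mem_cons_of_mem _ hl)⟩
    · have hmap : s₁.active.map (fun a => (Function.update s₁.newLabel u [(u, 0)] a).length *
          A.scatterCost a) = s₁.active.map fun a => (s₁.newLabel a).length * A.scatterCost a := by
        refine List.map_congr_left fun a ha => ?_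
        have : a ≠ u := by rintro rfl; exact hua ha
        rw [Function.update_of_ne this]
      simp only [AdjLists.activeCost, AdjLists.rootCost, Mem.pushActive, Mem.pushLabel,
        Mem.setNewLabel, List.map_cons, List.sum_cons, hmap, Function.update_self,
        List.length_singleton] at ht hlen ⊢
      omega
  · simp [AdjLists.activeCost, hs.active]
  · rintro s' t ⟨⟨h₁, h₂, h₃, h₄, h₅, h₆, h₇⟩, hact, -, -, ht⟩
    refine ⟨⟨h₁, h₂, fun x h hh => ?_, fun x h hh hi => ?_, fun x h hc => ?_, fun a ha => ?_⟩,
      h₅, h₆, h₇, ?_⟩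
    · rcases h₃ x h hh with h' | h'
      · rw [add_mul]; omega
      · exact h'.2.1.2
    · rcases h₃ x h hh with h' | h'
      · omega
      · exact Or.inr h'.1
    · simp [h₄] at hc
    · have := hact a ha
      rw [this.1]
      refine ⟨by simp, fun h hh => ?_⟩
      simp only [hubs_cons, hubs_nil, List.mem_singleton] at hh
      subst hh
      exact ⟨.refl, this.2.1⟩
    · simp only [List.map_nil, List.sum_nil] at ht
      omega

/-- The rounds for one batch. -/
theorem bvc_rounds (A : AdjLists G) (hK : ∀ x, (reaching G π x).card ≤ K) {s : Mem V}
    (hs : BvcInv G π b i s) (hmsgs : ∀ x, s.msgs x = []) (hrec : s.receivers = []) :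
    WP (Cmd.loop (fun s => !s.active.isEmpty)
      (bvcScatter A π ;; Cmd.op Mem.clearActive ;; bvcGather π b)) s
      fun s' t => BvcInv G π b i s' ∧ s'.active = [] ∧ (∀ x, s'.msgs x = []) ∧
        s'.receivers = [] ∧ t + candPotential A π K (i * b) s' ≤
          candPotential A π K (i * b) s + A.activeCost s + 1 := by
  set N := candPotential A π K (i * b) s + A.activeCost s
  refine (WP.loop N (fun s' t => (BvcInv G π b i s' ∧ (∀ x, s'.msgs x = []) ∧
    s'.receivers = []) ∧ t + candPotential A π K (i * b) s' + A.activeCost s' ≤ N)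
    (fun _ _ h => by omega) ?_ s 0 ⟨⟨hs, hmsgs, hrec⟩, by omega⟩).mono ?_
  · rintro s₁ t ⟨⟨h₁, h₂, h₃⟩, ht⟩ hb
    -- One active vertex suffices for the surplus of the scatter phase to cover the constant costs
    -- of the round.
    have hpos : 0 < s₁.active.length := List.length_pos_iff.2 (by simpa using hb)
    apply WP.seq
    refine (wp_bvcScatter (K := K) A h₁ h₂ h₃).mono ?_
    rintro s₂ t₂ ⟨h₄, h₅, h₆, h₇, ht₂⟩
    apply WP.seq; apply WP.op
    refine (wp_bvcGather (K := K) A hK (s := Mem.clearActive s₂) ⟨h₄.batchNo, h₄.labelOK,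
      h₄.hub_lt, h₄.cand_of_hub, h₄.cand, by simp [Mem.clearActive]⟩ h₅ h₆ rfl).mono ?_
    rintro s₃ t₃ ⟨h₈, h₉, h₁₀, ht₃⟩
    refine ⟨⟨h₈, h₉, h₁₀⟩, ?_⟩
    have : candPotential A π K (i * b) (Mem.clearActive s₂) = candPotential A π K (i * b) s₂ := rfl
    omega
  · rintro s' t ⟨hb, t₀, rfl, ⟨h₁, h₂, h₃⟩, ht⟩
    exact ⟨h₁, by simpa using hb, h₂, h₃, by omega⟩

/-- The potential of the batches that are still to come. -/
noncomputable def batchPotential (A : AdjLists G) (π : VertexOrder V) (K m : ℕ) : ℕ :=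
  ∑ u, (if m ≤ π u then A.rootCost K u else 0) +
    ∑ p ∈ reachPairs G π, (if m ≤ π p.1 then A.msgCost K p.2 + 2 else 0)

/-- The charges telescope over the batches: batch `i` consumes the charges of its own hubs and
leaves those of the later ones for the next batches. -/
theorem wp_bvcPLL (A : AdjLists G) (hK : ∀ x, (reaching G π x).card ≤ K) (hb : 1 ≤ b) :
    WP (bvcPLL A π b) (Mem.start V) fun _ t =>
      t ≤ batchPotential A π K 0 + 12 * Fintype.card V + 1 := by
  apply WP.seq; apply WP.forList_op
  have hinit : ∀ (l : List V) (s : Mem V), s.label = (fun _ => []) →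
      l.foldl (fun s x => Mem.setLabel x [] s) s = s := by
    intro l
    induction l with
    | nil => exact fun _ _ => rfl
    | cons x l ih =>
      intro s h
      have : Mem.setLabel x [] s = s := by
        have h' : Function.update s.label x [] = s.label :=
          Function.update_eq_self_iff.2 (by rw [h])
        rw [Mem.setLabel, h']
      rw [List.foldl_cons, this, ih s h]
  rw [hinit _ _ rfl, π.length_vertices]
  set n := Fintype.card V
  -- The term `10 * n` covers the constant costs per batch, for there are at most `n` batches when
  -- `1 ≤ b`.
  set N := batchPotential A π K 0 + 10 * n
  refine (WP.loop N (fun s t => ∃ i, BatchInv G π b i s ∧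
    t + batchPotential A π K (i * b) + 10 * (n - i) ≤ N) (fun _ _ ⟨_, h⟩ => by omega) ?_ _ 0
    ⟨0, ⟨rfl, fun x => by simp [Mem.start], fun x => by simp [Mem.start], fun _ _ => rfl, rfl,
      fun _ => rfl, rfl, rfl⟩, by rw [zero_mul]; omega⟩).mono ?_
  · rintro s t ⟨i, hs, ht⟩ hlt
    rw [decide_eq_true_eq, hs.batchNo] at hlt
    have hin : i < n := lt_of_le_of_lt (Nat.le_mul_of_pos_right i hb) hlt
    apply WP.seq
    refine (bvc_roots A hK hs).mono ?_
    rintro s₁ t₁ ⟨h₁, h₂, h₃, h₄, ht₁⟩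
    apply WP.seq
    refine (bvc_rounds A hK h₁ h₂ h₃).mono ?_
    rintro s₂ t₂ ⟨h₅, h₆, h₇, h₈, ht₂⟩
    apply WP.seq; apply WP.forEach_op; apply WP.seq; apply WP.op; apply WP.op
    obtain ⟨f, hf, hf'⟩ := foldl_clearCand s₂.candTrail s₂
    rw [hf]
    refine ⟨i + 1, ⟨by simp [Mem.nextBatch, Mem.clearCandTrail, h₅.batchNo], h₅.labelOK, h₅.hub_lt,
      fun x h => ?_, h₆, h₇, h₈, rfl⟩, ?_⟩
    · have := hf' x h
      by_contra hc
      have h₉ := this.1 (by simpa [Mem.nextBatch, Mem.clearCandTrail] using hc)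
      exact h₉.2 (h₅.cand x h h₉.1).2.2
    · have hroot : ((batch π b i).map (A.rootCost K)).sum +
          ∑ u, (if (i + 1) * b ≤ π u then A.rootCost K u else 0) ≤
            ∑ u, (if i * b ≤ π u then A.rootCost K u else 0) := by
        rw [← List.sum_toFinset _ nodup_batch, ← Finset.sum_filter, ← Finset.sum_filter,
          ← Finset.sum_union]
        · refine Finset.sum_le_sum_of_subset fun u hu => ?_
          simp only [Finset.mem_union, List.mem_toFinset, Finset.mem_filter, Finset.mem_univ,
            true_and] at hu ⊢
          rcases hu with hu | hu
          · exact (inBatch_of_mem_batch hu).1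
          · rw [add_mul] at hu; omega
        · rw [Finset.disjoint_left]
          intro u hu hu'
          simp only [List.mem_toFinset, Finset.mem_filter, Finset.mem_univ, true_and] at hu hu'
          have := (inBatch_of_mem_batch hu).2
          omega
      have hstart : candPotential A π K (i * b) s₁ ≤
          ∑ p ∈ reachPairs G π, (if i * b ≤ π p.1 then A.msgCost K p.2 + 2 else 0) := by
        simp only [candPotential, h₂, h₄, List.length_nil, zero_mul, Finset.sum_const_zero,
          mul_zero, add_zero]
        refine Finset.sum_le_sum fun p _ => ?_
        split_ifs
        · cases s₁.cand p.2 p.1 <;> simp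
        · exact le_rfl
      -- Candidate bits are set only for hubs of the current batch, so the charges of later hubs are
      -- still intact.
      have hend : ∑ p ∈ reachPairs G π, (if (i + 1) * b ≤ π p.1 then A.msgCost K p.2 + 2 else 0) +
          2 * s₂.candTrail.length ≤ candPotential A π K (i * b) s₂ := by
        refine Nat.add_le_add_right (le_trans ?_ (Nat.le_add_right _ _)) _
        refine Finset.sum_le_sum fun p _ => ?_
        by_cases hp : (i + 1) * b ≤ π p.1
        · have hc : s₂.cand p.2 p.1 = false := by
            by_contra hc
            have := (h₅.cand p.2 p.1 (by simpa using hc)).2.1.2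
            omega
          have hp' : i * b ≤ π p.1 := by rw [add_mul] at hp; omega
          rw [if_pos hp, if_pos hp', hc, cond_false]
        · rw [if_neg hp]
          exact Nat.zero_le _
      simp only [batchPotential] at ht ⊢
      omega
  · rintro s t ⟨-, t₀, rfl, i, -, ht⟩
    omega

omit [DecidableEq V] in
theorem batchPotential_le (A : AdjLists G) (hK : ∀ x, (reaching G π x).card ≤ K) :
    batchPotential A π K 0 ≤ 100 * (Fintype.card V * K ^ 2 + A.size * K) := by
  simp only [batchPotential, Nat.zero_le, if_true]
  have h₁ := sum_reachPairs_le hK fun x => A.msgCost K x + 2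
  have h₂ : ∑ x, (A.msgCost K x + 2) = Fintype.card V * (42 + 2 * K) + 40 * A.size := by
    simp only [AdjLists.msgCost, AdjLists.scatterCost, AdjLists.size, Finset.sum_add_distrib,
      Finset.sum_const, Finset.card_univ, smul_eq_mul, Finset.mul_sum]
    ring
  have h₄ : ∑ x, A.rootCost K x = Fintype.card V * (20 + 2 * K) + 40 * A.size := by
    simp only [AdjLists.rootCost, AdjLists.scatterCost, AdjLists.size, Finset.sum_add_distrib,
      Finset.sum_const, Finset.card_univ, smul_eq_mul, Finset.mul_sum]
    ring
  rw [h₂] at h₁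
  rw [h₄]
  refine (Nat.add_le_add_left h₁ _).trans ?_
  rcases isEmpty_or_nonempty V with hV | ⟨⟨x⟩⟩
  · simp [AdjLists.size]
  · have h₃ := one_le_of_card_reaching hK x
    nlinarith [Nat.mul_le_mul_left A.size h₃, Nat.mul_le_mul_left (Fintype.card V) h₃,
      Nat.mul_le_mul_left (Fintype.card V * K) h₃]

end BVC

/-! ### Canonical hubs -/

section Canonical

variable {V : Type u} [Fintype V] {G : SimpleGraph V} {π : VertexOrder V}

/-- The vertex `h` has the highest rank among the vertices on the shortest paths from `h` to `x`. -/
def Canonical (G : SimpleGraph V) (π : VertexOrder V) (h x : V) : Prop :=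
  G.Reachable h x ∧
    ∀ y, G.Reachable h y → G.dist h y + G.dist y x = G.dist h x → π h ≤ π y

/-- Take the vertex of highest rank on the shortest paths from `u` to `x`. Shortest paths from it to
either end are parts of such paths, so it has the highest rank on them too. -/
theorem exists_canonical {u x : V} (hux : G.Reachable u x) :
    ∃ h, Canonical G π h u ∧ Canonical G π h x ∧ G.dist h u + G.dist h x = G.dist u x := by
  classical
  obtain ⟨h, hh, hmin⟩ := Finset.exists_min_image
    ({y | G.Reachable u y ∧ G.dist u y + G.dist y x = G.dist u x} : Finset V) π
    ⟨u, by simp⟩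
  simp only [Finset.mem_filter, Finset.mem_univ, true_and] at hh hmin
  refine ⟨h, ⟨hh.1.symm, fun y hy he => ?_⟩, ⟨hh.1.symm.trans hux, fun y hy he => ?_⟩, ?_⟩
  · refine hmin y ⟨hh.1.trans hy, ?_⟩
    have h₁ := (hy.symm.dist_triangle_left x : G.dist y x ≤ G.dist y h + G.dist h x)
    have h₂ := ((hh.1.trans hy).dist_triangle_left x : G.dist u x ≤ G.dist u y + G.dist y x)
    rw [G.dist_comm (u := y) (v := u), G.dist_comm (u := h) (v := u)] at he
    rw [G.dist_comm (u := y) (v := h)] at h₁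
    omega
  · refine hmin y ⟨hh.1.trans hy, ?_⟩
    have h₁ := (hh.1.dist_triangle_left y : G.dist u y ≤ G.dist u h + G.dist h y)
    have h₂ := ((hh.1.trans hy).dist_triangle_left x : G.dist u x ≤ G.dist u y + G.dist y x)
    omega
  · rw [G.dist_comm (u := h) (v := u)]
    exact hh.2

/-- A canonical hub arrives by an edge from a vertex of which it is a canonical hub. -/
theorem Canonical.exists_adj {u x : V} {k : ℕ} (h : Canonical G π u x) (hd : G.dist u x = k + 1) :
    ∃ a, G.Adj a x ∧ G.dist u a = k ∧ Canonical G π u a ∧ π u < π x := by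
  obtain ⟨p, hp⟩ := h.1.symm.exists_walk_length_eq_dist
  rw [G.dist_comm, hd] at hp
  cases p with
  | nil => simp at hp
  | @cons _ a _ ha p =>
    rw [SimpleGraph.Walk.length_cons] at hp
    have hua : G.Reachable u a := p.reachable.symm
    have h₁ : G.dist u a ≤ k := by
      rw [G.dist_comm]
      exact (SimpleGraph.dist_le p).trans (by omega)
    have h₂ := (hua.dist_triangle_left x : G.dist u x ≤ G.dist u a + G.dist a x)
    have h₃ : G.dist a x = 1 := SimpleGraph.dist_eq_one_iff_adj.2 ha.symm
    have hda : G.dist u a = k := by omega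
    -- A vertex on a shortest path from `u` to `a` also lies on one from `u` to `x`, so `a` inherits
    -- canonicity.
    refine ⟨a, ha.symm, hda, ⟨hua, fun y hy he => h.2 y hy ?_⟩, lt_of_le_of_ne ?_ ?_⟩
    · have h₄ := (ha.symm.reachable.dist_triangle_right y : G.dist y x ≤ G.dist y a + G.dist a x)
      have h₅ := (hy.dist_triangle_left x : G.dist u x ≤ G.dist u y + G.dist y x)
      omega
    · exact h.2 x h.1 (by simp)
    · intro he
      rw [π.injective he, G.dist_self] at hd
      omega

end Canonical

/-! ### Vertex-centric pruned landmark labeling -/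

/-! ### What a distance check computes -/

section DistanceCheck

variable {V : Type u} [DecidableEq V]

/-- Without repeated hubs no written value is overwritten later. -/
theorem foldl_setDist (g : V × ℕ → ℕ∞) (l : List (V × ℕ)) (hl : (hubs l).Nodup) (s : Mem V) :
    ∃ f, l.foldl (fun s e => Mem.setDist e.1 (g e) s) s = { s with dist := f } ∧
      (∀ h, h ∉ hubs l → f h = s.dist h) ∧ ∀ e ∈ l, f e.1 = g e := by
  induction l generalizing s with
  | nil => exact ⟨s.dist, rfl, fun _ _ => rfl, by simp⟩
  | cons e l ih =>
    rw [hubs_cons, List.nodup_cons] at hl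
    obtain ⟨f, hf, h₁, h₂⟩ := ih hl.2 (Mem.setDist e.1 (g e) s)
    refine ⟨f, hf, fun h hh => ?_, fun e' he' => ?_⟩
    · rw [hubs_cons, List.mem_cons, not_or] at hh
      exact (h₁ h hh.2).trans (Function.update_of_ne hh.1 _ _)
    · rcases List.mem_cons.1 he' with rfl | he'
      · exact (h₁ _ hl.1).trans (Function.update_self _ _ _)
      · exact h₂ e' he'

omit [DecidableEq V] in
theorem foldl_updateBest (l : List (V × ℕ)) (s : Mem V) :
    ∃ b, l.foldl (fun s e => Mem.updateBest (fun s => s.dist e.1) (fun _ => e.2) s) s =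
      { s with best := b } ∧ ∀ n, n < b ↔ n < s.best ∧ ∀ e ∈ l, n < s.dist e.1 + e.2 := by
  induction l generalizing s with
  | nil => exact ⟨s.best, rfl, by simp⟩
  | cons e l ih =>
    obtain ⟨b, hb, h⟩ := ih (Mem.updateBest (fun s => s.dist e.1) (fun _ => e.2) s)
    refine ⟨b, hb, fun n => ?_⟩
    rw [h]
    simp only [Mem.updateBest, lt_min_iff, List.forall_mem_cons]
    tauto

/-- A hub outside the label of `u` finds `⊤` in the array, so only common hubs constrain the
minimum; the final traversal restores the array. The minimum is described by the numbers strictly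
below it, as the algorithm tests it. -/
theorem wp_vcDistanceCheck {s : Mem V} {u x : V} {K : ℕ} (hu : (hubs (s.label u)).Nodup)
    (hdist : ∀ h, s.dist h = ⊤) (hlu : (s.label u).length ≤ K) (hlx : (s.label x).length ≤ K) :
    WP (vcDistanceCheck u x) s fun s' t => t ≤ 6 * K + 4 ∧ ∃ b, s' = { s with best := b } ∧
      ∀ n : ℕ, (n : ℕ∞) < b ↔
        ∀ h d₁ d₂, (h, d₁) ∈ s.label u → (h, d₂) ∈ s.label x → n < d₁ + d₂ := by
  apply WP.seq; apply WP.op; apply WP.seq; apply WP.forEach_op; apply WP.seq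
  apply WP.forEach_op; apply WP.forEach_op
  obtain ⟨f, hf, hf₁, hf₂⟩ := foldl_setDist (fun e => (e.2 : ℕ∞)) (s.label u) hu (Mem.resetBest s)
  rw [show (Mem.resetBest s).label u = s.label u from rfl, hf]
  simp only [Mem.resetBest] at hf₁ ⊢
  obtain ⟨b, hb, hb'⟩ := foldl_updateBest (s.label x) { s with best := ⊤, dist := f }
  rw [hb]
  obtain ⟨f', hf', hf₁', hf₂'⟩ := foldl_setDist (fun _ => ⊤) (s.label u) hu
    { s with best := b, dist := f }
  rw [hf']
  refine ⟨by dsimp only; omega, b, ?_, fun n => ?_⟩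
  · have : f' = s.dist := by
      funext h
      rw [hdist]
      by_cases hh : h ∈ hubs (s.label u)
      · obtain ⟨d, hd⟩ := mem_hubs.1 hh
        exact hf₂' _ hd
      · rw [hf₁' h hh]
        exact (hf₁ h hh).trans (hdist h)
    rw [this]
  · rw [hb']
    simp only [ENat.natCast_lt_top, true_and]
    constructor
    · intro h₁ h d₁ d₂ hd₁ hd₂
      have := h₁ _ hd₂
      rw [hf₂ _ hd₁] at this
      exact_mod_cast this
    · rintro h₁ ⟨h, d₂⟩ hd₂
      by_cases hh : h ∈ hubs (s.label u)
      · obtain ⟨d₁, hd₁⟩ := mem_hubs.1 hh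
        rw [hf₂ _ hd₁]
        exact_mod_cast h₁ h d₁ d₂ hd₁ hd₂
      · rw [hf₁ h hh, hdist]
        simp

end DistanceCheck

/-! ### The scatter phase of VC-PLL and the exactness of its labels -/

section VC

variable {V : Type u} [Fintype V] [DecidableEq V] {G : SimpleGraph V}

/-- The invariant of VC-PLL after `k` rounds. -/
structure VcInv (G : SimpleGraph V) (π : VertexOrder V) (k : ℕ) (s : Mem V) : Prop where
  labelOK : LabelOK G π s.label
  inLabel : ∀ x h, s.inLabel x h = true ↔ h ∈ hubs (s.label x)
  exact : ∀ x h d, (h, d) ∈ s.label x → d = G.dist h x ∧ d ≤ k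
  complete : ∀ x h, Canonical G π h x → G.dist h x ≤ k → h ∈ hubs (s.label x)
  newest : ∀ x h, (h, k) ∈ s.label x → x ∈ s.active ∧ (h, k) ∈ s.newLabel x
  newLabel : ∀ a ∈ s.active, s.newLabel a ≠ [] ∧ ∀ e ∈ s.newLabel a, e ∈ s.label a ∧ e.2 = k
  msgs : ∀ x, s.msgs x = []
  receivers : s.receivers = []
  seen : ∀ x, s.seen x = false
  dist : ∀ x, s.dist x = ⊤

/-- The memory `s'` is obtained from `s` by sending messages as in the scatter phase. -/
structure VcSent (A : AdjLists G) (π : VertexOrder V) (s s' : Mem V) : Prop where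
  eq : s' = { s with msgs := s'.msgs, receivers := s'.receivers }
  box : Mailbox s'.receivers s'.msgs
  sound : ∀ x, ∀ e ∈ s'.msgs x, ∃ a ∈ s.active, x ∈ A.nbrs a ∧ π e.1 < π x ∧
    s.inLabel x e.1 = false ∧ ∃ d, (e.1, d) ∈ s.newLabel a ∧ e.2 = d + 1

/-- The number of messages. -/
def Mem.msgCount (s : Mem V) : ℕ := ∑ x, (s.msgs x).length

variable {π : VertexOrder V} {K k : ℕ}

/-- Sending takes at most 4 steps including the test; each message also receives 20 units in advance
for its handling in the gather phase. -/
theorem vc_message (A : AdjLists G) {a x : V} {e : V × ℕ} {s s₁ : Mem V} (ha : a ∈ s.active)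
    (hx : x ∈ A.nbrs a) (he : e ∈ s.newLabel a) (hs : VcSent A π s s₁) :
    WP (Cmd.when (fun s => decide (π e.1 < π x) && !s.inLabel x e.1) (send x (e.1, e.2 + 1))) s₁
      fun s₂ t => VcSent A π s s₂ ∧ (∀ y, s₁.msgs y ⊆ s₂.msgs y) ∧
        (π e.1 < π x → s.inLabel x e.1 = false → (e.1, e.2 + 1) ∈ s₂.msgs x) ∧
        t + 20 * s₂.msgCount ≤ 20 * s₁.msgCount + 24 := by
  have hin : s₁.inLabel = s.inLabel := by rw [hs.eq]
  apply WP.when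
  · intro hc
    simp only [Bool.and_eq_true, Bool.not_eq_true', decide_eq_true_eq, hin] at hc
    apply wp_send
    intro t ht
    refine ⟨⟨?_, hs.box.deliver _ _, fun y f hf => ?_⟩, fun y => ?_, fun _ _ => ?_, ?_⟩
    · conv_lhs => rw [hs.eq]
      rfl
    · simp only [Mem.deliver] at hf
      by_cases hy : y = x
      · subst hy
        rw [Function.update_self] at hf
        rcases List.mem_cons.1 hf with rfl | hf
        · exact ⟨a, ha, hx, hc.1, hc.2, e.2, he, rfl⟩
        · exact hs.sound y f hf
      · rw [Function.update_of_ne hy] at hf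
        exact hs.sound y f hf
    · simp only [Mem.deliver]
      by_cases hy : y = x
      · subst hy; simp
      · rw [Function.update_of_ne hy]
        exact List.Subset.refl _
    · simp [Mem.deliver]
    · have := sum_le_sum_add (S := Finset.univ)
        (f := fun y => (Function.update s₁.msgs x ((e.1, e.2 + 1) :: s₁.msgs x) y).length)
        (g := fun y => (s₁.msgs y).length) (a := x) (c := 1)
        (Finset.mem_univ _) (by simp) (fun y _ hy => by rw [Function.update_of_ne hy])
      simp only [Mem.msgCount, Mem.deliver]
      omega
  · intro hc
    refine ⟨hs, fun y => List.Subset.refl _, fun h₁ h₂ => ?_, by omega⟩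
    simp [h₁, h₂, hin] at hc

/-- Apart from the cost, it matters that no required message is omitted: the completeness of the
labels in the next round rests on this. -/
theorem wp_vcScatter (A : AdjLists G) {s : Mem V} (hs : VcInv G π k s) :
    WP (vcScatter A π) s fun s' t => VcSent A π s s' ∧
      (∀ a ∈ s.active, ∀ x ∈ A.nbrs a, ∀ e ∈ s.newLabel a, π e.1 < π x →
        s.inLabel x e.1 = false → (e.1, e.2 + 1) ∈ s'.msgs x) ∧
      t + 20 * s'.msgCount + 9 * s.active.length ≤ A.activeCost s + 1 := by
  apply WP.read
  refine (WP.forList (fun l s' t => VcSent A π s s' ∧ l ⊆ s.active ∧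
    (∀ a ∈ s.active, a ∈ l ∨ ∀ x ∈ A.nbrs a, ∀ e ∈ s.newLabel a, π e.1 < π x →
        s.inLabel x e.1 = false → (e.1, e.2 + 1) ∈ s'.msgs x) ∧
    t + 20 * s'.msgCount + 9 * s.active.length +
    (l.map fun a => (s.newLabel a).length * A.scatterCost a).sum ≤
      A.activeCost s + 9 * l.length) ?_ s.active s 0 ⟨⟨rfl, ?_, ?_⟩,
      List.Subset.refl _, fun a ha => Or.inl ha, ?_⟩).mono ?_
  · rintro a l s₁ t ⟨hJ, hl, hdone, ht⟩
    rw [List.cons_subset] at hl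
    have hne := List.length_pos_iff.2 (hs.newLabel a hl.1).1
    refine (WP.forList (fun xs s' t => VcSent A π s s' ∧ xs ⊆ A.nbrs a ∧
      (∀ y, s₁.msgs y ⊆ s'.msgs y) ∧
      (∀ x ∈ A.nbrs a, x ∈ xs ∨ ∀ e ∈ s.newLabel a, π e.1 < π x →
        s.inLabel x e.1 = false → (e.1, e.2 + 1) ∈ s'.msgs x) ∧
      t + 20 * s'.msgCount + xs.length * (25 * (s.newLabel a).length + 2) ≤
        20 * s₁.msgCount + (A.nbrs a).length * (25 * (s.newLabel a).length + 2)) ?_ (A.nbrs a) s₁ 0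
        ⟨hJ, List.Subset.refl _, fun _ => List.Subset.refl _, fun x hx => Or.inl hx,
          by rw [zero_add]⟩).mono ?_
    · rintro x xs s₂ t₂ ⟨hJ₂, hxs, hmono₂, hdone₂, ht₂⟩
      rw [List.cons_subset] at hxs
      apply WP.read
      have hnew : s₂.newLabel = s.newLabel := by rw [hJ₂.eq]
      rw [hnew]
      refine (WP.forList (fun es s' t => VcSent A π s s' ∧ es ⊆ s.newLabel a ∧
        (∀ y, s₂.msgs y ⊆ s'.msgs y) ∧
        (∀ e ∈ s.newLabel a, e ∈ es ∨ (π e.1 < π x →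
          s.inLabel x e.1 = false → (e.1, e.2 + 1) ∈ s'.msgs x)) ∧
        t + 20 * s'.msgCount + 25 * es.length ≤ 20 * s₂.msgCount + 25 * (s.newLabel a).length)
          ?_ _ _ 0 ⟨hJ₂, List.Subset.refl _, fun _ => List.Subset.refl _, fun e he => Or.inl he,
            by omega⟩).mono ?_
      · rintro e es s₃ t₃ ⟨hJ₃, hes, hmono₃, hdone₃, ht₃⟩
        rw [List.cons_subset] at hes
        refine (vc_message A hl.1 hxs.1 hes.1 hJ₃).mono ?_
        rintro s₄ t₄ ⟨h₁, h₂, h₃, ht₄⟩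
        refine ⟨h₁, hes.2, fun y => List.Subset.trans (hmono₃ y) (h₂ y), fun f hf => ?_, ?_⟩
        · rcases hdone₃ f hf with h | h
          · rcases List.mem_cons.1 h with rfl | h
            · exact Or.inr h₃
            · exact Or.inl h
          · exact Or.inr fun h₅ h₆ => h₂ _ (h h₅ h₆)
        · rw [List.length_cons] at ht₃
          omega
      · rintro s₃ t₃ ⟨hJ₃, -, hmono₃, hdone₃, ht₃⟩
        refine ⟨hJ₃, hxs.2, fun y => List.Subset.trans (hmono₂ y) (hmono₃ y), fun z hz => ?_, ?_⟩
        · rcases hdone₂ z hz with h | h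
          · rcases List.mem_cons.1 h with rfl | h
            · exact Or.inr fun e he => (hdone₃ e he).resolve_left List.not_mem_nil
            · exact Or.inl h
          · exact Or.inr fun e he h₅ h₆ => hmono₃ _ (h e he h₅ h₆)
        · rw [List.length_cons, add_mul] at ht₂
          rw [List.length_nil] at ht₃
          omega
    · rintro s₂ t₂ ⟨hJ₂, -, hmono₂, hdone₂, ht₂⟩
      refine ⟨hJ₂, hl.2, fun c hc => ?_, ?_⟩
      · rcases hdone c hc with h | h
        · rcases List.mem_cons.1 h with rfl | h
          · exact Or.inr fun x hx => (hdone₂ x hx).resolve_left List.not_mem_nil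
          · exact Or.inl h
        · exact Or.inr fun x hx e he h₅ h₆ => hmono₂ _ (h x hx e he h₅ h₆)
      · simp only [List.map_cons, List.sum_cons, List.length_cons] at ht
        have : t₂ + 20 * s₂.msgCount + 1 + 9 ≤ 20 * s₁.msgCount +
            (s.newLabel a).length * A.scatterCost a := by
          simp only [AdjLists.scatterCost, List.length_nil] at ht₂ ⊢
          nlinarith [Nat.mul_le_mul_left (A.nbrs a).length hne]
        omega
  · rw [hs.receivers]
    exact Mailbox.empty hs.msgs
  · intro x e he
    simp [hs.msgs x] at he
  · have : s.msgCount = 0 := by simp [Mem.msgCount, hs.msgs]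
    rw [this, AdjLists.activeCost]
    omega
  · rintro s' t ⟨h₁, -, h₂, ht⟩
    simp only [List.map_nil, List.sum_nil, List.length_nil] at ht
    exact ⟨h₁, fun a ha => (h₂ a ha).resolve_left List.not_mem_nil, by omega⟩

/-- The invariant of the gather phase in round `k + 1` of VC-PLL. -/
structure VcMid (G : SimpleGraph V) (π : VertexOrder V) (k : ℕ) (s : Mem V) : Prop where
  labelOK : LabelOK G π s.label
  inLabel : ∀ x h, s.inLabel x h = true ↔ h ∈ hubs (s.label x)
  exact : ∀ x h d, (h, d) ∈ s.label x → d = G.dist h x ∧ d ≤ k + 1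
  complete : ∀ x h, Canonical G π h x → G.dist h x ≤ k → h ∈ hubs (s.label x)
  arriving : ∀ x h, Canonical G π h x → G.dist h x = k + 1 →
    h ∈ hubs (s.label x) ∨ h ∈ hubs (s.msgs x)
  newest : ∀ x h, (h, k + 1) ∈ s.label x → x ∈ s.active ∧ (h, k + 1) ∈ s.newLabel x
  newLabel : ∀ a ∈ s.active, s.newLabel a ≠ [] ∧ ∀ e ∈ s.newLabel a, e ∈ s.label a ∧ e.2 = k + 1
  msgs : ∀ x, ∀ e ∈ s.msgs x, e.2 = k + 1 ∧ Reach G π e.1 x ∧ e.1 ∉ hubs (s.label x) ∧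
    ∃ a, G.Adj a x ∧ G.dist e.1 a = k
  active : ∀ a ∈ s.active, s.msgs a = []
  seen : ∀ x, s.seen x = false
  dist : ∀ x, s.dist x = ⊤

/-- A canonical hub of `x` at distance `k + 1` is a canonical hub at distance `k` of some neighbour
of `x`. There it was added in the latest round, so it has just been sent to `x`. -/
theorem VcSent.vcMid {A : AdjLists G} {s s' : Mem V} (h : VcSent A π s s') (hs : VcInv G π k s)
    (hall : ∀ a ∈ s.active, ∀ x ∈ A.nbrs a, ∀ e ∈ s.newLabel a, π e.1 < π x →
        s.inLabel x e.1 = false → (e.1, e.2 + 1) ∈ s'.msgs x) :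
    VcMid G π k (Mem.clearActive s') := by
  have e₁ : s'.label = s.label := by rw [h.eq]
  have e₂ : s'.inLabel = s.inLabel := by rw [h.eq]
  have e₃ : s'.seen = s.seen := by rw [h.eq]
  have e₄ : s'.dist = s.dist := by rw [h.eq]
  have hnot : ∀ x y, s.inLabel x y = false ↔ y ∉ hubs (s.label x) := by
    intro x y
    rw [← hs.inLabel, Bool.not_eq_true]
  constructor
  all_goals simp only [Mem.clearActive, e₁, e₂, e₃, e₄]
  · exact hs.labelOK
  · exact hs.inLabel
  · intro x y d hd
    have := hs.exact x y d hd
    exact ⟨this.1, by omega⟩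
  · exact hs.complete
  · intro x y hc hd
    right
    obtain ⟨a, hax, hda, hca, hlt⟩ := hc.exists_adj hd
    obtain ⟨d, hmem⟩ := mem_hubs.1 (hs.complete a y hca hda.le)
    have hdk : d = k := (hs.exact a y d hmem).1.trans hda
    rw [hdk] at hmem
    have hnew := hs.newest a y hmem
    refine mem_hubs.2 ⟨k + 1, hall a hnew.1 x ((A.mem_nbrs a x).2 hax) (y, k) hnew.2 hlt ?_⟩
    rw [hnot]
    intro hin
    obtain ⟨d', hd'⟩ := mem_hubs.1 hin
    have := hs.exact x y d' hd'
    omega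
  · intro x y hd
    have := hs.exact x y _ hd
    omega
  · intro a ha
    simp at ha
  · intro x e he
    obtain ⟨a, ha, hax, hlt, hin, d, hd, hed⟩ := h.sound x e he
    have hnew := (hs.newLabel a ha).2 _ hd
    have hadj := (A.mem_nbrs a x).1 hax
    have hdk : d = k := hnew.2
    subst hdk
    refine ⟨hed, ?_, (hnot _ _).1 hin, a, hadj, (hs.exact a _ _ hnew.1).1.symm⟩
    exact ((hs.labelOK a).2 _ (mem_hubs_of_mem hnew.1)).tail ⟨hadj, hlt⟩
  · intro a ha
    simp at ha
  · exact hs.seen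
  · exact hs.dist

-- With all messages treated, `arriving` raises completeness from distance `k` to `k + 1`.
omit [DecidableEq V] in
theorem VcMid.vcInv {s : Mem V} (h : VcMid G π k s) (hm : ∀ x, s.msgs x = []) :
    VcInv G π (k + 1) (Mem.clearReceivers s) where
  labelOK := h.labelOK
  inLabel := h.inLabel
  exact := h.exact
  complete x y hc hd := by
    rcases Nat.lt_or_ge k (G.dist y x) with hlt | hle
    · refine (h.arriving x y hc (by omega)).resolve_right ?_
      simp [hm x]
    · exact h.complete x y hc hle
  newest := h.newest
  newLabel := h.newLabel
  msgs := hm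
  receivers := rfl
  seen := h.seen
  dist := h.dist

omit [DecidableEq V] in
/-- In round `k + 1`, exactly the distances `k + 1` pass the distance check, and the canonical ones
do pass. -/
theorem VcMid.of_check {s : Mem V} (hs : VcMid G π k s) {x u : V} (hr : Reach G π u x)
    (hu : u ∉ hubs (s.label x)) :
    ((∀ h d₁ d₂, (h, d₁) ∈ s.label u → (h, d₂) ∈ s.label x → k + 1 < d₁ + d₂) →
      k + 1 ≤ G.dist u x) ∧
    (Canonical G π u x → G.dist u x = k + 1 →
      ∀ h d₁ d₂, (h, d₁) ∈ s.label u → (h, d₂) ∈ s.label x → k + 1 < d₁ + d₂) := by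
  constructor
  · intro hcheck
    by_contra hlt
    -- If the distance were at most `k`, this canonical hub would already be in both labels with the
    -- exact distance as sum, and the check would reject.
    obtain ⟨h, h₁, h₂, hd⟩ := exists_canonical (π := π) hr.reachable
    obtain ⟨d₁, hd₁⟩ := mem_hubs.1 (hs.complete u h h₁ (by omega))
    obtain ⟨d₂, hd₂⟩ := mem_hubs.1 (hs.complete x h h₂ (by omega))
    have := hcheck h d₁ d₂ hd₁ hd₂
    have := (hs.exact u h d₁ hd₁).1
    have := (hs.exact x h d₂ hd₂).1
    omega
  · intro hc hd h d₁ d₂ hd₁ hd₂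
    by_contra hlt
    have h₁ := (hs.exact u h d₁ hd₁).1
    have h₂ := (hs.exact x h d₂ hd₂).1
    have hru := (hs.labelOK u).2 h (mem_hubs_of_mem hd₁)
    have h₃ := (hru.reachable.symm.dist_triangle_left x : G.dist u x ≤ G.dist u h + G.dist h x)
    rw [G.dist_comm] at h₁
    -- A hub defeating the check lies on a shortest path from `u` to `x`, so `u` ranks at least as
    -- high. As a hub of `u` it also ranks at least as high as `u`; hence it is `u`, which is not
    -- yet a hub of `x`.
    have h₄ := hc.2 h hru.reachable.symm (by omega)
    have : h = u := π.injective (le_antisymm hru.le h₄)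
    subst this
    exact hu (mem_hubs_of_mem hd₂)

end VC

/-! ### The gather phase of VC-PLL and the total charge -/

section VC

variable {V : Type u} [Fintype V] [DecidableEq V] {G : SimpleGraph V}

/-- The charge for the distance checks of the pairs `(u, x)`, where `st` is the number of rounds
that have been finished: a pair is checked in at most three rounds. -/
noncomputable def checkPotential (G : SimpleGraph V) (π : VertexOrder V) (K : ℕ)
    (st : V × V → ℕ) : ℕ :=
  ∑ p ∈ reachPairs G π, (6 * K + 10) * min 3 (G.dist p.1 p.2 + 2 - st p)

/-- The potential of the label entries that are still to be added. -/
noncomputable def labelPotential (A : AdjLists G) (π : VertexOrder V) (s : Mem V) : ℕ :=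
  ∑ p ∈ reachPairs G π, cond (s.inLabel p.2 p.1) 0 (A.scatterCost p.2 + 10)

variable {π : VertexOrder V} {K k : ℕ}

omit [DecidableEq V] in
theorem checkPotential_anti {st st' : V × V → ℕ} (h : ∀ p, st p ≤ st' p) :
    checkPotential G π K st' ≤ checkPotential G π K st := by
  refine Finset.sum_le_sum fun p _ => Nat.mul_le_mul_left _ ?_
  have := h p
  omega

/-- For the label potential, where a receiver releases the charges of all its accepted hubs at once.
-/
theorem sum_add_card_mul_le_sum {α : Type*} {S T : Finset α} {f g : α → ℕ} {c : ℕ} (hT : T ⊆ S)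
    (hc : ∀ a ∈ T, f a + c ≤ g a) (h : ∀ b ∈ S, f b ≤ g b) :
    ∑ b ∈ S, f b + T.card * c ≤ ∑ b ∈ S, g b := by
  classical
  rw [← Finset.sum_sdiff hT, ← Finset.sum_sdiff hT, add_assoc, ← smul_eq_mul, ← Finset.sum_const,
    ← Finset.sum_add_distrib]
  exact Nat.add_le_add (Finset.sum_le_sum fun b hb => h b (Finset.mem_sdiff.1 hb).1)
    (Finset.sum_le_sum hc)

/-- The traversal of the messages of `x` in the gather phase. -/
theorem vc_messages (hK : ∀ x, (reaching G π x).card ≤ K) {x : V} {s : Mem V}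
    (hs : VcMid G π k s) (st : V → ℕ) :
    WP (Cmd.forEach (fun s => s.msgs x) fun e =>
      Cmd.when (fun s => !s.seen e.1)
        (Cmd.op (Mem.setSeen e.1 true) ;;
        vcDistanceCheck e.1 x ;;
        Cmd.when (fun s => decide ((e.2 : ℕ∞) < s.best)) (Cmd.op (Mem.pushNewLabel x e))))
      (Mem.setNewLabel x [] s)
      fun s' t => ∃ l sn best,
        s' = { s with newLabel := Function.update s.newLabel x l, seen := sn, best := best } ∧
        (hubs l).Nodup ∧ (∀ e ∈ l, e ∈ s.msgs x ∧ G.dist e.1 x = k + 1) ∧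
        (∀ h, sn h = true → h ∈ hubs (s.msgs x)) ∧
        (∀ h ∈ hubs (s.msgs x), Canonical G π h x → G.dist h x = k + 1 → h ∈ hubs l) ∧
        t + checkPotential G π K (fun p => if p.2 = x then k + 1 else st p.2) ≤
          checkPotential G π K (fun p => if p.2 = x then k else st p.2) +
            5 * (s.msgs x).length + 1 := by
  -- During the traversal for `x`, the pair `(h, x)` counts as finished with round `k + 1` once the
  -- flag of `h` is raised.
  let stage : (V → Bool) → V × V → ℕ := fun sn p =>
    if p.2 = x then cond (sn p.1) (k + 1) k else st p.2
  apply WP.read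
  refine (WP.forList (fun ms s' t => ∃ l sn best,
    s' = { s with newLabel := Function.update s.newLabel x l, seen := sn, best := best } ∧
    ((hubs l).Nodup ∧ (∀ h ∈ hubs l, sn h = true) ∧
    (∀ e ∈ l, e ∈ s.msgs x ∧ G.dist e.1 x = k + 1) ∧
    (∀ h, sn h = true → h ∈ hubs (s.msgs x)) ∧
    (∀ h ∈ hubs (s.msgs x), h ∈ hubs ms ∨ sn h = true) ∧
    (∀ h, sn h = true → Canonical G π h x → G.dist h x = k + 1 → h ∈ hubs l) ∧ ms ⊆ s.msgs x) ∧
    t + checkPotential G π K (stage sn) + 5 * ms.length ≤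
      checkPotential G π K (stage fun _ => false) + 5 * (s.msgs x).length)
    ?_ _ _ 0 ⟨[], fun _ => false, s.best, ?_, ⟨by simp, by simp, by simp, by simp,
      fun h hh => Or.inl hh, by simp, List.Subset.refl _⟩, by
        rw [zero_add]⟩).mono ?_
  · rintro e ms _ t ⟨l, sn, best, rfl, ⟨hnd, hsn, hl, hsnm, hrem, hcan, hms⟩, ht⟩
    rw [List.cons_subset] at hms
    obtain ⟨he₂, hre, heL, a, hax, hda⟩ := hs.msgs x e hms.1
    rw [List.length_cons] at ht
    apply WP.when
    · intro hc
      simp only [Bool.not_eq_true'] at hc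
      have hel : e.1 ∉ hubs l := fun h => by rw [hsn _ h] at hc; simp at hc
      apply WP.seq; apply WP.op; apply WP.seq
      refine (wp_vcDistanceCheck (K := K) (x := x) (s := Mem.setSeen e.1 true
        { s with newLabel := Function.update s.newLabel x l, seen := sn, best := best })
        (hs.labelOK e.1).1 hs.dist (hs.labelOK.length_le hK _)
        (hs.labelOK.length_le hK _)).mono ?_
      rintro _ t₁ ⟨ht₁, b, rfl, hb⟩
      have hchk := hs.of_check hre heL
      have hpot : checkPotential G π K (stage (Function.update sn e.1 true)) + (6 * K + 10) ≤
          checkPotential G π K (stage sn) := by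
        have h₁ := (hax.reachable.dist_triangle_right e.1 :
          G.dist e.1 x ≤ G.dist e.1 a + G.dist a x)
        have h₂ := (hre.reachable.dist_triangle_left a :
          G.dist e.1 a ≤ G.dist e.1 x + G.dist x a)
        have h₃ : G.dist a x = 1 := SimpleGraph.dist_eq_one_iff_adj.2 hax
        rw [G.dist_comm (u := x), h₃] at h₂
        refine sum_add_le_sum (a := (e.1, x)) (mem_reachPairs.2 hre) ?_ fun p _ hp => ?_
        · simp only [stage, if_true, Function.update_self, hc, cond_true, cond_false]
          -- The sender is adjacent to `x` and at distance `k` from the hub, so `G.dist e.1 x + 2 -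
          -- k` lies between 1 and 3 and drops by exactly one. This is where "at most three rounds"
          -- comes from.
          have : min 3 (G.dist e.1 x + 2 - k) = min 3 (G.dist e.1 x + 2 - (k + 1)) + 1 := by omega
          rw [this, mul_add, mul_one]
        · have : stage (Function.update sn e.1 true) p = stage sn p := by
            by_cases hpx : p.2 = x
            · have hp₁ : p.1 ≠ e.1 := fun hp₁ => hp (Prod.ext hp₁ hpx)
              simp only [stage, Function.update_of_ne hp₁]
            · simp only [stage, if_neg hpx]
          rw [this]
      have hup : ∀ h, Function.update sn e.1 true h = true ↔ h = e.1 ∨ sn h = true := by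
        intro h
        by_cases hh : h = e.1
        · subst hh; simp
        · simp [hh]
      have hsnm' : ∀ h, Function.update sn e.1 true h = true → h ∈ hubs (s.msgs x) := by
        intro h hh
        rcases (hup h).1 hh with rfl | hh
        · exact mem_hubs_of_mem hms.1
        · exact hsnm h hh
      have hrem' : ∀ h ∈ hubs (s.msgs x), h ∈ hubs ms ∨ Function.update sn e.1 true h = true := by
        intro h hh
        rw [hup]
        rcases hrem h hh with h' | h'
        · rcases List.mem_cons.1 h' with h' | h'
          · exact Or.inr (Or.inl h')
          · exact Or.inl h'
        · exact Or.inr (Or.inr h')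
      have hiff := hb (k + 1)
      apply WP.when
      · intro hlt
        simp only [decide_eq_true_eq, he₂] at hlt
        have hd : G.dist e.1 x = k + 1 := by
          have h₁ := hchk.1 (hiff.1 hlt)
          have h₂ := (hax.reachable.dist_triangle_right e.1 :
            G.dist e.1 x ≤ G.dist e.1 a + G.dist a x)
          have h₃ : G.dist a x = 1 := SimpleGraph.dist_eq_one_iff_adj.2 hax
          omega
        apply WP.op
        refine ⟨e :: l, Function.update sn e.1 true, b, ?_, ⟨?_, fun h hh => ?_, fun f hf => ?_,
          hsnm', hrem', fun h hh h₁ h₂ => ?_, hms.2⟩, by omega⟩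
        · simp [Mem.pushNewLabel, Mem.setSeen]
        · rw [hubs_cons, List.nodup_cons]
          exact ⟨hel, hnd⟩
        · rw [hup]
          rcases List.mem_cons.1 hh with h' | h'
          · exact Or.inl h'
          · exact Or.inr (hsn h h')
        · rcases List.mem_cons.1 hf with rfl | hf
          · exact ⟨hms.1, hd⟩
          · exact hl f hf
        · rw [hubs_cons, List.mem_cons]
          rcases (hup h).1 hh with h' | h'
          · exact Or.inl h'
          · exact Or.inr (hcan h h' h₁ h₂)
      · intro hlt
        simp only [decide_eq_false_iff_not, he₂] at hlt
        refine ⟨l, Function.update sn e.1 true, b, rfl, ⟨hnd, fun h hh => (hup h).2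
          (Or.inr (hsn h hh)), hl, hsnm', hrem', fun h hh h₁ h₂ => ?_, hms.2⟩, by omega⟩
        rcases (hup h).1 hh with rfl | h'
        · exact absurd (hiff.2 (hchk.2 h₁ h₂)) hlt
        · exact hcan h h' h₁ h₂
    · intro hc
      simp only [Bool.not_eq_false'] at hc
      refine ⟨l, sn, best, rfl, ⟨hnd, hsn, hl, hsnm, fun h hh => ?_, hcan, hms.2⟩, by omega⟩
      rcases hrem h hh with h' | h'
      · rcases List.mem_cons.1 h' with rfl | h'
        · exact Or.inr hc
        · exact Or.inl h'
      · exact Or.inr h'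
  · have : s.seen = fun _ => false := funext hs.seen
    rw [← this]
    rfl
  · rintro _ t ⟨l, sn, best, rfl, ⟨hnd, -, hl, hsnm, hrem, hcan, -⟩, ht⟩
    refine ⟨l, sn, best, rfl, hnd, hl, hsnm, fun h hh => hcan h ((hrem h hh).resolve_left ?_), ?_⟩
    · exact List.not_mem_nil
    · have h₁ : checkPotential G π K (fun p => if p.2 = x then k + 1 else st p.2) ≤
          checkPotential G π K (stage sn) := by
        refine checkPotential_anti fun p => ?_
        simp only [stage]
        split_ifs
        · cases sn p.1 <;> simp
        · exact le_rfl
      have h₂ : checkPotential G π K (stage fun _ => false) =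
        checkPotential G π K (fun p => if p.2 = x then k else st p.2) := rfl
      rw [List.length_nil] at ht
      omega

/-- The memory after the treatment of a receiver `x` that accepts the messages `l`. -/
def Mem.vcAccept (x : V) (l : List (V × ℕ)) (best : ℕ∞) (inLabel : V → V → Bool) (s : Mem V) :
    Mem V :=
  { s with
    newLabel := Function.update s.newLabel x l
    best := best
    msgs := Function.update s.msgs x []
    label := Function.update s.label x (l.reverse ++ s.label x)
    active := if l.isEmpty then s.active else x :: s.active
    inLabel := inLabel }

theorem vc_receiver (hK : ∀ x, (reaching G π x).card ≤ K) {x : V} {s : Mem V}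
    (hs : VcMid G π k s) (st : V → ℕ) :
    WP (Cmd.op (Mem.setNewLabel x []) ;;
    (Cmd.forEach (fun s => s.msgs x) fun e =>
      Cmd.when (fun s => !s.seen e.1)
        (Cmd.op (Mem.setSeen e.1 true) ;;
        vcDistanceCheck e.1 x ;;
        Cmd.when (fun s => decide ((e.2 : ℕ∞) < s.best)) (Cmd.op (Mem.pushNewLabel x e)))) ;;
    (Cmd.forEach (fun s => s.msgs x) fun e => Cmd.op (Mem.setSeen e.1 false)) ;;
    Cmd.op (Mem.clearMsgs x) ;;
    Cmd.when (fun s => !(s.newLabel x).isEmpty)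
      ((Cmd.forEach (fun s => s.newLabel x) fun e =>
        Cmd.op (Mem.pushLabel x e) ;; Cmd.op (Mem.markInLabel x e.1)) ;;
      Cmd.op (Mem.pushActive x))) s
      fun s' t => ∃ l best inL, s' = Mem.vcAccept x l best inL s ∧
        (∀ y h, inL y h = true ↔ s.inLabel y h = true ∨ (y = x ∧ h ∈ hubs l)) ∧
        (hubs l).Nodup ∧ (∀ e ∈ l, e ∈ s.msgs x ∧ G.dist e.1 x = k + 1) ∧
        (∀ h ∈ hubs (s.msgs x), Canonical G π h x → G.dist h x = k + 1 → h ∈ hubs l) ∧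
        t + checkPotential G π K (fun p => if p.2 = x then k + 1 else st p.2) ≤
          checkPotential G π K (fun p => if p.2 = x then k else st p.2) +
            7 * (s.msgs x).length + 3 * l.length + 7 := by
  apply WP.seq; apply WP.op; apply WP.seq
  refine (vc_messages hK hs st).mono ?_
  rintro _ t ⟨l, sn, best, rfl, hnd, hl, hsn, hcan, ht⟩
  apply WP.seq; apply WP.forEach_op; apply WP.seq; apply WP.op
  obtain ⟨f, hf, hf'⟩ := foldl_clearSeen (hubs (s.msgs x))
    { s with newLabel := Function.update s.newLabel x l, seen := sn, best := best }
  rw [hubs, List.foldl_map] at hf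
  -- Flags were raised only for hubs among the messages, so clearing those restores the array.
  have hseen : f = s.seen := by
    funext h
    rw [hs.seen, ← Bool.not_eq_true, hf']
    exact fun hh => hh.2 (hsn h hh.1)
  simp only [hf, hseen]
  apply WP.when
  · intro hne
    simp only [Mem.clearMsgs, Function.update_self, Bool.not_eq_true'] at hne
    apply WP.seq; apply WP.read
    simp only [Mem.clearMsgs, Function.update_self]
    refine (WP.forList (fun es s' t => ∃ p inL, p.reverse ++ es = l ∧
      s' = { s with
        newLabel := Function.update s.newLabel x l
        best := best
        msgs := Function.update s.msgs x []
        label := Function.update s.label x (p ++ s.label x)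
        inLabel := inL } ∧
      (∀ y h, inL y h = true ↔ s.inLabel y h = true ∨ (y = x ∧ h ∈ hubs p)) ∧
      t + 3 * es.length ≤ 3 * l.length)
      ?_ l _ 0 ⟨[], s.inLabel, rfl, by simp, by simp, by omega⟩).mono ?_
    · rintro e es _ t ⟨p, inL, hp, rfl, hin, ht⟩
      apply WP.seq; apply WP.op; apply WP.op
      refine ⟨e :: p, Function.update inL x (Function.update (inL x) e.1 true), by simpa using hp,
        by simp [Mem.pushLabel, Mem.markInLabel], fun y h => ?_, ?_⟩
      · by_cases hy : y = x
        · subst hy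
          by_cases hh : h = e.1
          · subst hh; simp
          · simp [hh, hin]
        · simp [hy, hin]
      · rw [List.length_cons] at ht
        omega
    · rintro _ t₂ ⟨p, inL, hp, rfl, hin, ht₂⟩
      rw [List.append_nil] at hp
      apply WP.op
      have hp' : p ≠ [] := by rintro rfl; simp [← hp] at hne
      refine ⟨l, best, inL, ?_, ?_, hnd, hl, hcan, ?_⟩
      · simp [Mem.vcAccept, Mem.pushActive, hp', ← hp]
      · intro y h
        rw [hin, ← hp, hubs_reverse, List.mem_reverse]
      · rw [List.length_nil] at ht₂
        omega
  · intro he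
    simp only [Mem.clearMsgs, Function.update_self, Bool.not_eq_false', List.isEmpty_iff] at he
    subst he
    refine ⟨[], best, s.inLabel, ?_, by simp, hnd, hl, hcan, ?_⟩
    · simp [Mem.vcAccept, Mem.clearMsgs]
    · omega

/-- Distance checks are paid by `checkPotential`, the handling of possibly repeated messages by the
20 units each carries, and accepted entries by `labelPotential`, which passes `scatterCost x` on to
`activeCost`. A pair has finished `k` rounds while its receiver is waiting, and `k + 1` afterwards.
-/
theorem wp_vcGather (A : AdjLists G) (hK : ∀ x, (reaching G π x).card ≤ K) {s : Mem V}
    (hs : VcMid G π k s) (hbox : Mailbox s.receivers s.msgs) (hact : s.active = []) :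
    WP vcGather s fun s' t => VcInv G π (k + 1) s' ∧
      t + checkPotential G π K (fun _ => k + 1) + labelPotential A π s' + A.activeCost s' ≤
        checkPotential G π K (fun _ => k) + labelPotential A π s + 20 * s.msgCount + 2 := by
  apply WP.seq; apply WP.read
  refine (WP.forList (fun l s' t => VcMid G π k s' ∧ Mailbox l s'.msgs ∧
    t + checkPotential G π K (fun p => if p.2 ∈ l then k else k + 1) + labelPotential A π s' +
      A.activeCost s' + 20 * s'.msgCount ≤
        checkPotential G π K (fun _ => k) + labelPotential A π s + 20 * s.msgCount)
    ?_ _ _ 0 ⟨hs, hbox, ?_⟩).mono ?_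
  · rintro x l s₁ t ⟨hs₁, hbox₁, ht⟩
    refine (vc_receiver hK hs₁ fun y => if y ∈ l then k else k + 1).mono ?_
    rintro _ t' ⟨nl, best, inL, rfl, hin, hnd, hnl, hcan, ht'⟩
    have hne : s₁.msgs x ≠ [] := (hbox₁.mem x).1 List.mem_cons_self
    have hpos := List.length_pos_iff.2 hne
    have hxact : x ∉ s₁.active := fun h => hne (hs₁.active x h)
    have hxl := (List.nodup_cons.1 hbox₁.nodup).1
    have hmsg : ∀ h ∈ hubs nl, Reach G π h x ∧ h ∉ hubs (s₁.label x) := by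
      intro h hh
      obtain ⟨d, hd⟩ := mem_hubs.1 hh
      have := hs₁.msgs x _ (hnl _ hd).1
      exact ⟨this.2.1, this.2.2.1⟩
    have hlab : ∀ h, h ∈ hubs (nl.reverse ++ s₁.label x) ↔ h ∈ hubs nl ∨ h ∈ hubs (s₁.label x) := by
      intro h; simp
    have hlab' : ∀ e, e ∈ nl.reverse ++ s₁.label x ↔ e ∈ nl ∨ e ∈ s₁.label x := by
      intro e; simp
    have hsub : ∀ y, ∀ h ∈ hubs (s₁.label y),
        h ∈ hubs (Function.update s₁.label x (nl.reverse ++ s₁.label x) y) := by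
      intro y h hh
      by_cases hy : y = x
      · subst hy
        rw [Function.update_self, hlab]
        exact Or.inr hh
      · rwa [Function.update_of_ne hy]
    have hactive : ∀ a, a ∈ (if nl.isEmpty then s₁.active else x :: s₁.active) ↔
        a ∈ s₁.active ∨ (a = x ∧ nl ≠ []) := by
      intro a
      cases nl <;> simp [or_comm]
    refine ⟨⟨?_, ?_, ?_, ?_, ?_, ?_, ?_, ?_, ?_, hs₁.seen, hs₁.dist⟩, hbox₁.clear, ?_⟩
    · intro y
      simp only [Mem.vcAccept]
      by_cases hy : y = x
      · subst hy
        rw [Function.update_self]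
        constructor
        · rw [hubs_append, hubs_reverse, List.nodup_append]
          refine ⟨List.nodup_reverse.2 hnd, (hs₁.labelOK y).1, ?_⟩
          rintro a ha c hc rfl
          exact (hmsg a (List.mem_reverse.1 ha)).2 hc
        · intro h hh
          rcases (hlab h).1 hh with hh | hh
          · exact (hmsg h hh).1
          · exact (hs₁.labelOK y).2 h hh
      · rw [Function.update_of_ne hy]
        exact hs₁.labelOK y
    · intro y h
      simp only [Mem.vcAccept]
      rw [hin, hs₁.inLabel]
      by_cases hy : y = x
      · subst hy
        rw [Function.update_self, hlab]
        tauto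
      · rw [Function.update_of_ne hy]
        tauto
    · intro y h d
      simp only [Mem.vcAccept]
      by_cases hy : y = x
      · subst hy
        rw [Function.update_self, hlab']
        rintro (hd | hd)
        · have h₁ := hnl _ hd
          have h₂ : d = k + 1 := (hs₁.msgs y _ h₁.1).1
          exact ⟨h₂.trans h₁.2.symm, h₂.le⟩
        · exact hs₁.exact y h d hd
      · rw [Function.update_of_ne hy]
        exact hs₁.exact y h d
    · exact fun y h hc hd => hsub y h (hs₁.complete y h hc hd)
    · intro y h hc hd
      simp only [Mem.vcAccept]
      rcases hs₁.arriving y h hc hd with h' | h'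
      · exact Or.inl (hsub y h h')
      · by_cases hy : y = x
        · subst hy
          rw [Function.update_self, hlab]
          exact Or.inl (Or.inl (hcan h h' hc hd))
        · rw [Function.update_of_ne hy, Function.update_of_ne hy]
          exact Or.inr h'
    · intro y h
      simp only [Mem.vcAccept, hactive]
      by_cases hy : y = x
      · subst hy
        rw [Function.update_self, Function.update_self, hlab']
        rintro (hd | hd)
        · exact ⟨Or.inr ⟨rfl, List.ne_nil_of_mem hd⟩, hd⟩
        · exact absurd (hs₁.newest y h hd).1 hxact
      · rw [Function.update_of_ne hy, Function.update_of_ne hy]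
        exact fun hd => ⟨Or.inl (hs₁.newest y h hd).1, (hs₁.newest y h hd).2⟩
    · intro a
      simp only [Mem.vcAccept, hactive]
      by_cases hy : a = x
      · subst hy
        rw [Function.update_self, Function.update_self]
        intro h
        refine ⟨(h.resolve_left hxact).2, fun e he => ?_⟩
        rw [hlab']
        exact ⟨Or.inl he, (hs₁.msgs a e (hnl e he).1).1⟩
      · rw [Function.update_of_ne hy, Function.update_of_ne hy]
        exact fun h => hs₁.newLabel a (h.resolve_right fun h => hy h.1)
    · intro y e
      simp only [Mem.vcAccept]
      by_cases hy : y = x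
      · subst hy; simp
      · rw [Function.update_of_ne hy, Function.update_of_ne hy]
        exact hs₁.msgs y e
    · intro a
      simp only [Mem.vcAccept, hactive]
      by_cases hy : a = x
      · subst hy; simp
      · rw [Function.update_of_ne hy]
        exact fun h => hs₁.active a (h.resolve_right fun h => hy h.1)
    · have h₁ := sum_add_le_sum (S := Finset.univ)
        (f := fun y => (Function.update s₁.msgs x [] y).length)
        (g := fun y => (s₁.msgs y).length) (a := x) (c := (s₁.msgs x).length)
        (Finset.mem_univ _) (by simp) (fun y _ hy => by rw [Function.update_of_ne hy])
      have h₁' : (Mem.vcAccept x nl best inL s₁).msgCount + (s₁.msgs x).length ≤ s₁.msgCount := h₁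
      have h₂ : A.activeCost (Mem.vcAccept x nl best inL s₁) ≤
          A.activeCost s₁ + nl.length * A.scatterCost x := by
        have hmap : s₁.active.map (fun a => (Function.update s₁.newLabel x nl a).length *
            A.scatterCost a) = s₁.active.map fun a => (s₁.newLabel a).length * A.scatterCost a := by
          refine List.map_congr_left fun a ha => ?_
          have : a ≠ x := by rintro rfl; exact hxact ha
          rw [Function.update_of_ne this]
        simp only [AdjLists.activeCost, Mem.vcAccept]
        split_ifs
        · rw [hmap]; omega
        · rw [List.map_cons, List.sum_cons, hmap, Function.update_self]
          omega
      -- The accepted hubs are distinct and new in the label of `x`, so each releases a charge of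
      -- its own.
      have h₃ : labelPotential A π (Mem.vcAccept x nl best inL s₁) +
          nl.length * (A.scatterCost x + 10) ≤ labelPotential A π s₁ := by
        have hcard : ((hubs nl).toFinset.image fun h => (h, x)).card = nl.length := by
          rw [Finset.card_image_of_injective _ fun a b h => congrArg Prod.fst h,
            List.toFinset_card_of_nodup hnd, length_hubs]
        rw [← hcard]
        refine sum_add_card_mul_le_sum ?_ ?_ ?_
        · intro p hp
          obtain ⟨h, hh, rfl⟩ := Finset.mem_image.1 hp
          exact mem_reachPairs.2 (hmsg h (List.mem_toFinset.1 hh)).1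
        · intro p hp
          obtain ⟨h, hh, rfl⟩ := Finset.mem_image.1 hp
          rw [List.mem_toFinset] at hh
          have e₁ : inL x h = true := (hin x h).2 (Or.inr ⟨rfl, hh⟩)
          have e₂ : s₁.inLabel x h = false := by
            rw [← Bool.not_eq_true, hs₁.inLabel]
            exact (hmsg h hh).2
          simp [Mem.vcAccept, e₁, e₂]
        · intro p _
          cases hp : s₁.inLabel p.2 p.1 with
          | true => simp [Mem.vcAccept, (hin p.2 p.1).2 (Or.inl hp)]
          | false => cases hp' : inL p.2 p.1 <;> simp [Mem.vcAccept, hp']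
      have h₄ : checkPotential G π K (fun p => if p.2 ∈ l then k else k + 1) ≤
          checkPotential G π K
            (fun p => if p.2 = x then k + 1 else if p.2 ∈ l then k else k + 1) := by
        refine checkPotential_anti fun p => ?_
        by_cases hp : p.2 = x
        · rw [if_pos hp, hp, if_neg hxl]
        · rw [if_neg hp]
      have h₅ : checkPotential G π K
            (fun p => if p.2 = x then k else if p.2 ∈ l then k else k + 1) ≤
          checkPotential G π K (fun p => if p.2 ∈ x :: l then k else k + 1) := by
        refine checkPotential_anti fun p => ?_
        by_cases hp : p.2 = x
        · simp [hp]
        · simp [hp]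
      rw [mul_add] at h₃
      omega
  · have h₁ : A.activeCost s = 0 := by simp [AdjLists.activeCost, hact]
    have h₂ : checkPotential G π K (fun p => if p.2 ∈ s.receivers then k else k + 1) ≤
        checkPotential G π K (fun _ => k) :=
      checkPotential_anti fun p => by split_ifs <;> omega
    omega
  · rintro s' t ⟨hs', hbox', ht⟩
    apply WP.op
    refine ⟨hs'.vcInv hbox'.eq_nil, ?_⟩
    have h₁ : labelPotential A π (Mem.clearReceivers s') = labelPotential A π s' := rfl
    have h₂ : A.activeCost (Mem.clearReceivers s') = A.activeCost s' := rfl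
    simp only [List.not_mem_nil, if_false] at ht
    omega

/-- The labels `{(x, 0)}` satisfy the invariant of VC-PLL. -/
theorem vc_init (A : AdjLists G) (π : VertexOrder V) :
    WP (Cmd.forList π.vertices fun x =>
      Cmd.op (Mem.setNewLabel x [(x, 0)]) ;;
      Cmd.op (Mem.setLabel x [(x, 0)]) ;;
      Cmd.op (Mem.markInLabel x x) ;;
      Cmd.op (Mem.pushActive x)) (Mem.start V)
      fun s t => VcInv G π 0 s ∧
        t + A.activeCost s ≤ 5 * Fintype.card V + ∑ x, A.scatterCost x := by
  refine (WP.forList (fun l s t =>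
    (∀ x, (x ∈ l ∧ ∀ h, s.inLabel x h = false) ∨ (x ∉ l ∧ s.label x = [(x, 0)] ∧
      s.newLabel x = [(x, 0)] ∧ (∀ h, s.inLabel x h = true ↔ h = x) ∧ x ∈ s.active)) ∧
    (∀ a ∈ s.active, a ∉ l) ∧ l.Nodup ∧ (∀ x, s.msgs x = []) ∧ s.receivers = [] ∧
    (∀ x, s.seen x = false) ∧ (∀ x, s.dist x = ⊤) ∧
    t + A.activeCost s + 5 * l.length + (l.map A.scatterCost).sum ≤
      5 * Fintype.card V + ∑ x, A.scatterCost x) ?_ _ _ 0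
    ⟨fun x => Or.inl ⟨π.mem_vertices x, fun _ => rfl⟩, by simp [Mem.start], π.nodup_vertices,
      fun _ => rfl, rfl, fun _ => rfl, fun _ => rfl, ?_⟩).mono ?_
  · rintro x l s t ⟨h₁, h₂, h₃, h₄, h₅, h₆, h₇, ht⟩
    rw [List.nodup_cons] at h₃
    have hxa : x ∉ s.active := fun h => h₂ x h List.mem_cons_self
    have hx : ∀ h, s.inLabel x h = false := by
      rcases h₁ x with h | h
      · exact h.2
      · exact absurd List.mem_cons_self h.1
    apply WP.seq; apply WP.op; apply WP.seq; apply WP.op; apply WP.seq; apply WP.op; apply WP.op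
    refine ⟨fun y => ?_, fun a ha => ?_, h₃.2, h₄, h₅, h₆, h₇, ?_⟩
    · simp only [Mem.pushActive, Mem.markInLabel, Mem.setLabel, Mem.setNewLabel]
      by_cases hy : y = x
      · subst hy
        refine Or.inr ⟨h₃.1, by simp, by simp, fun h => ?_, by simp⟩
        by_cases hh : h = y
        · simp [hh]
        · simp [hh, hx]
      · simp only [Function.update_of_ne hy, List.mem_cons]
        have := h₁ y
        simp only [List.mem_cons] at this
        tauto
    · rcases List.mem_cons.1 ha with rfl | ha
      · exact h₃.1
      · exact fun hl => h₂ a ha (List.mem_cons_of_mem _ hl)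
    · have hmap : s.active.map (fun a => (Function.update s.newLabel x [(x, 0)] a).length *
          A.scatterCost a) = s.active.map fun a => (s.newLabel a).length * A.scatterCost a := by
        refine List.map_congr_left fun a ha => ?_
        have : a ≠ x := by rintro rfl; exact hxa ha
        rw [Function.update_of_ne this]
      simp only [AdjLists.activeCost, Mem.pushActive, Mem.markInLabel, Mem.setLabel,
        Mem.setNewLabel, List.map_cons, List.sum_cons, hmap, Function.update_self,
        List.length_nil, List.length_cons, zero_add, one_mul] at ht ⊢
      omega
  · rw [π.sum_vertices, π.length_vertices]
    simp [AdjLists.activeCost, Mem.start]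
  · rintro s t ⟨h₁, -, -, h₄, h₅, h₆, h₇, ht⟩
    have h : ∀ x, s.label x = [(x, 0)] ∧ s.newLabel x = [(x, 0)] ∧
        (∀ h, s.inLabel x h = true ↔ h = x) ∧ x ∈ s.active :=
      fun x => ((h₁ x).resolve_left fun h => List.not_mem_nil h.1).2
    refine ⟨⟨fun x => ?_, fun x y => ?_, fun x y d hd => ?_, fun x y hc hd => ?_, fun x y hd => ?_,
      fun a _ => ?_, h₄, h₅, h₆, h₇⟩, ?_⟩
    · rw [(h x).1]
      refine ⟨by simp, fun y hy => ?_⟩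
      simp only [hubs_cons, hubs_nil, List.mem_singleton] at hy
      subst hy
      exact .refl
    · rw [(h x).1, (h x).2.2.1]
      simp
    · rw [(h x).1, List.mem_singleton, Prod.mk.injEq] at hd
      obtain ⟨rfl, rfl⟩ := hd
      simp
    · rw [(h x).1]
      have := hc.1.dist_eq_zero_iff.1 (Nat.le_zero.1 hd)
      simp [this]
    · rw [(h x).1] at hd
      rw [(h x).2.1]
      exact ⟨(h x).2.2.2, hd⟩
    · rw [(h a).1, (h a).2.1]
      refine ⟨by simp, fun e he => ⟨he, ?_⟩⟩
      rw [List.mem_singleton] at he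
      rw [he]
    · simp only [List.map_nil, List.sum_nil, List.length_nil] at ht
      omega

/-- The bound for VC-PLL in terms of the charges. -/
noncomputable def AdjLists.vcCost (A : AdjLists G) (π : VertexOrder V) (K : ℕ) : ℕ :=
  ∑ _p ∈ reachPairs G π, (6 * K + 10) * 3 + ∑ p ∈ reachPairs G π, (A.scatterCost p.2 + 10) +
    5 * Fintype.card V + ∑ x, A.scatterCost x + 1

/-- No bound on the number of rounds is needed: each pair can pay for three distance checks and one
new entry, and every round has an active vertex that pays for its constant costs. -/
theorem wp_vcPLL (A : AdjLists G) (hK : ∀ x, (reaching G π x).card ≤ K) :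
    WP (vcPLL A π) (Mem.start V) fun _ t => t ≤ A.vcCost π K := by
  apply WP.seq
  refine (vc_init A π).mono ?_
  rintro s t₀ ⟨hs, ht₀⟩
  set N := checkPotential G π K (fun _ => 0) + labelPotential A π s + A.activeCost s
  refine (WP.loop N (fun s' t => ∃ k, VcInv G π k s' ∧
    t + checkPotential G π K (fun _ => k) + labelPotential A π s' + A.activeCost s' ≤ N)
    (fun _ _ ⟨_, h⟩ => by omega) ?_ s 0 ⟨0, hs, by omega⟩).mono ?_
  · rintro s₁ t ⟨k, h₁, ht⟩ hb
    have hpos : 0 < s₁.active.length := List.length_pos_iff.2 (by simpa using hb)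
    apply WP.seq
    refine (wp_vcScatter A h₁).mono ?_
    rintro s₂ t₂ ⟨hsent, hall, ht₂⟩
    apply WP.seq; apply WP.op
    refine (wp_vcGather A hK (hsent.vcMid h₁ hall) hsent.box rfl).mono ?_
    rintro s₃ t₃ ⟨h₃, ht₃⟩
    refine ⟨k + 1, h₃, ?_⟩
    have e₁ : labelPotential A π (Mem.clearActive s₂) = labelPotential A π s₁ := by
      rw [hsent.eq]
      rfl
    have e₂ : (Mem.clearActive s₂).msgCount = s₂.msgCount := rfl
    omega
  · rintro s' t ⟨-, t₁, rfl, k, -, ht⟩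
    have h₁ : checkPotential G π K (fun _ => 0) ≤ ∑ _p ∈ reachPairs G π, (6 * K + 10) * 3 :=
      Finset.sum_le_sum fun p _ => Nat.mul_le_mul_left _ (min_le_left _ _)
    have h₂ : labelPotential A π s ≤ ∑ p ∈ reachPairs G π, (A.scatterCost p.2 + 10) :=
      Finset.sum_le_sum fun p _ => by cases s.inLabel p.2 p.1 <;> simp
    simp only [AdjLists.vcCost]
    omega

omit [DecidableEq V] in
theorem vcCost_le (A : AdjLists G) (hK : ∀ x, (reaching G π x).card ≤ K) :
    A.vcCost π K ≤ 150 * (Fintype.card V * K ^ 2 + A.size * K) + 1 := by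
  simp only [AdjLists.vcCost]
  have h₁ := sum_reachPairs_le hK fun x => A.scatterCost x + 10
  have h₁' := sum_reachPairs_le hK fun _ => (6 * K + 10) * 3
  have h₂ : ∑ x, A.scatterCost x = Fintype.card V * 10 + 40 * A.size := by
    simp only [AdjLists.scatterCost, AdjLists.size, Finset.sum_add_distrib,
      Finset.sum_const, Finset.card_univ, smul_eq_mul, Finset.mul_sum]
    ring
  have h₄ : ∑ x, (A.scatterCost x + 10) = Fintype.card V * 20 + 40 * A.size := by
    rw [Finset.sum_add_distrib, h₂, Finset.sum_const, Finset.card_univ, smul_eq_mul]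
    ring
  rw [h₄] at h₁
  have h₅ : ∑ _x : V, (6 * K + 10) * 3 = Fintype.card V * ((6 * K + 10) * 3) := by
    rw [Finset.sum_const, Finset.card_univ, smul_eq_mul]
  rw [h₅] at h₁'
  rw [h₂]
  rcases isEmpty_or_nonempty V with hV | ⟨⟨x⟩⟩
  · simp only [AdjLists.size, Finset.univ_eq_empty, Finset.sum_empty, Fintype.card_eq_zero,
      zero_mul, mul_zero, add_zero] at h₁ h₁' ⊢
    omega
  · have h₃ := one_le_of_card_reaching hK x
    nlinarith [Nat.mul_le_mul_left A.size h₃, Nat.mul_le_mul_left (Fintype.card V) h₃,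
      Nat.mul_le_mul_left (Fintype.card V * K) h₃]

end VC

/-! ### The running time in terms of the width -/

theorem AdjLists.size_eq {V : Type u} [Fintype V] {G : SimpleGraph V} (A : AdjLists G) :
    A.size = 2 * G.edgeSet.ncard := by
  classical
  have h₁ : ∀ x, (A.nbrs x).length = G.degree x := by
    intro x
    rw [← List.toFinset_card_of_nodup (A.nodup x), ← SimpleGraph.card_neighborFinset_eq_degree]
    congr 1
    ext y
    simp [A.mem_nbrs]
  have h₂ : G.edgeSet.ncard = G.edgeFinset.card := by
    rw [← SimpleGraph.coe_edgeFinset, Set.ncard_coe_finset]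
  rw [h₂, ← G.sum_degrees_eq_twice_card_edges, AdjLists.size]
  exact Finset.sum_congr rfl fun x _ => h₁ x

theorem TreeDecomposition.two_le_card {V : Type u} [Fintype V] {G : SimpleGraph V} {ι : Type v}
    [Fintype ι] (D : TreeDecomposition G ι) (hw : 1 ≤ D.width) : 2 ≤ Fintype.card V := by
  have : (Finset.univ.sup fun i => (D.bag i).card) ≤ Fintype.card V :=
    Finset.sup_le fun i _ => Finset.card_le_univ _
  rw [TreeDecomposition.width] at hw
  omega

/-- For `n ≥ 2` both summands on the left are at most `log n / log 2`, and `2 / 0.69 < 3`. -/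
theorem natLog_add_one_le {n : ℕ} (hn : 2 ≤ n) : (Nat.log 2 n : ℝ) + 1 ≤ 3 * Real.log n := by
  have h₂ : (0.69 : ℝ) < Real.log 2 := lt_trans (by norm_num) Real.log_two_gt_d9
  have hn' : (2 : ℝ) ≤ n := by exact_mod_cast hn
  have h₁ : Real.log 2 ≤ Real.log n := Real.log_le_log (by norm_num) hn'
  have h₃ : (Nat.log 2 n : ℝ) * Real.log 2 ≤ Real.log n := by
    rw [← Real.log_pow]
    refine Real.log_le_log (by positivity) ?_
    exact_mod_cast Nat.pow_log_le_self 2 (by omega)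
  have h₄ : (0 : ℝ) ≤ Nat.log 2 n := Nat.cast_nonneg _
  nlinarith

/-- A bound in terms of the number of hubs that reach a vertex is a bound in terms of the width. -/
theorem le_treewidthBound {V : Type u} [Fintype V] {G : SimpleGraph V} (A : AdjLists G) {w K t : ℕ}
    (hn : 2 ≤ Fintype.card V) (hw : 1 ≤ w) (hK : K = (w + 1) * (Nat.log 2 (Fintype.card V) + 1))
    (ht : t ≤ 200 * (Fintype.card V * K ^ 2 + A.size * K)) :
    (t : ℝ) ≤ 7200 * treewidthBound G w := by
  have hlog := natLog_add_one_le hn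
  set n := Fintype.card V
  have hw' : (1 : ℝ) ≤ w := by exact_mod_cast hw
  have h₀ : (0 : ℝ) ≤ Nat.log 2 n := Nat.cast_nonneg _
  have hKle : (K : ℝ) ≤ 6 * (w * Real.log n) := by
    rw [hK]
    push_cast
    calc ((w : ℝ) + 1) * (Nat.log 2 n + 1) ≤ (2 * w) * (3 * Real.log n) := by
          gcongr
          linarith
      _ = _ := by ring
  have hK2 : (K : ℝ) ^ 2 ≤ (6 * (w * Real.log n)) ^ 2 := by gcongr
  have ht' : (t : ℝ) ≤ 200 * (n * K ^ 2 + 2 * G.edgeSet.ncard * K) := by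
    rw [A.size_eq] at ht
    exact_mod_cast ht
  have h₁ : (n : ℝ) * K ^ 2 ≤ n * (6 * (w * Real.log n)) ^ 2 := by gcongr
  have h₂ : 2 * (G.edgeSet.ncard : ℝ) * K ≤ 2 * G.edgeSet.ncard * (6 * (w * Real.log n)) := by
    gcongr
  have h₃ : (0 : ℝ) ≤ w * G.edgeSet.ncard * Real.log n := by
    have : (0 : ℝ) ≤ Real.log n := by linarith
    positivity
  -- The constant is `7200 = 200 * 6 ^ 2`, from the vertex term; the edge term needs only `200 * 2 *
  -- 6`.
  rw [treewidthBound]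
  nlinarith

theorem theorem2 :
    ∃ C : ℝ, 0 < C ∧
      ∀ (V : Type u) [Fintype V] [DecidableEq V] (G : SimpleGraph V)
        (ι : Type v) [Fintype ι] (D : TreeDecomposition G ι),
        1 ≤ D.width →
        ∃ π : VertexOrder V, ∀ A : AdjLists G,
          RunsInTime (vcPLL A π) (Mem.start V) (C * treewidthBound G D.width) ∧
          RunsInTime (pll A π) (Mem.start V) (C * treewidthBound G D.width) ∧
          ∀ b : ℕ, 1 ≤ b →
            RunsInTime (bvcPLL A π b) (Mem.start V) (C * treewidthBound G D.width) := by
  refine ⟨7200, by norm_num, fun V _ _ G ι _ D hw => ?_⟩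
  obtain ⟨π, hK⟩ := D.exists_order
  refine ⟨π, fun A => ?_⟩
  have hn := D.two_le_card hw
  set K := (D.width + 1) * (Nat.log 2 (Fintype.card V) + 1) with hKdef
  have hK1 : 1 ≤ K := Nat.mul_pos (by omega) (by omega)
  -- Absorbs the linear and constant terms of the bounds for VC-PLL and BVC-PLL, so that the factor
  -- 200 serves all three algorithms.
  have hnK : Fintype.card V ≤ Fintype.card V * K ^ 2 := Nat.le_mul_of_pos_right _ (by positivity)
  refine ⟨((wp_vcPLL A hK).mono fun _ t ht => ?_).runsInTime,
    ((wp_pll A hK).mono fun _ t ht => ?_).runsInTime,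
    fun b hb => ((wp_bvcPLL A hK hb).mono fun _ t ht => ?_).runsInTime⟩
  · have := vcCost_le A hK
    exact le_treewidthBound A hn hw hKdef (by omega)
  · have := sum_searchCost_le A hK
    exact le_treewidthBound A hn hw hKdef (by omega)
  · have := batchPotential_le A hK
    exact le_treewidthBound A hn hw hKdef (by omega)
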